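/- Let $d\in\{2,3\}$, let $\Omega\subset\mathbb R^d$ be a bounded domain with $C^2$ boundary, let $3<p<\infty$ and $p'=p/(p-1)$. Let $\mathring W^1_s(\Omega)$ be the closure of $C_0^\infty(\Omega)$ in $W^1_s(\Omega)$, $\mathbf H^{1,2}_0(\Omega)=\mathring W^1_2(\Omega)^d$, $L_{2,0}(\Omega)=\{q\in L_2(\Omega):\int_\Omega q=0\}$, and $$X=\mathring W^1_p(\Omega)\times\mathring W^1_p(\Omega)\times\mathbf H^{1,2}_0(\Omega)\times L_{2,0}(\Omega),\qquad Y=\mathring W^1_{p'}(\Omega)\times\mathring W^1_{p'}(\Omega)\times\mathbf H^{1,2}_0(\Omega)\times L_{2,0}(\Omega).$$ Let $h,k,\mu\in C^2(\mathbb R)$ with $h(s)=s(1-s)$ on $[0,1]$, with $k\ge k_0>0$ and $\mu\ge\mu_0>0$ on $\mathbb R$ for constants $k_0,\mu_0$, and with $h,k$ and their derivatives up to order $2$ bounded on $\mathbb R$. Let $f\in L_p(\Omega)$, $\mathbf g\in L_2(\Omega)^d$, let $\mathbf e_g\in\mathbb R^d$ be a unit vector, and let $\phi_D\in W^2_p(\Omega)$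 satisfy $0\le\phi_D\le1$ and $\Delta\phi_D=0$. For $U=(\tilde\phi,T,\mathbf u,\pi)\in X$ put $\phi=\phi_D+\tilde\phi$, $\eta=\rho=1+\phi$, $\mathbf j=-\nabla\phi-h(\phi)\nabla T$ and $D(\mathbf u)=\nabla\mathbf u+\nabla\mathbf u^T$, and define, for $(\psi,\varphi,\mathbf v,q)\in Y$, $$\begin{aligned}\langle\mathcal F(U),(\psi,\varphi,\mathbf v,q)\rangle={}&\int_\Omega\nabla\phi\cdot\nabla\psi+\int_\Omega h(\phi)\nabla T\cdot\nabla\psi+\int_\Omega\mathbf u\cdot\nabla\phi\,\psi\\&+\int_\Omega k(\phi)\nabla T\cdot\nabla\varphi+\int_\Omega(\mathbf j+\eta\mathbf u)\cdot\nabla T\,\varphi-\int_\Omega f\varphi\\&+\int_\Omega\tfrac{\mu(\phi)}2D(\mathbf u):D(\mathbf v)+\int_\Omega\big((\mathbf j+\rho\mathbf u)\cdot\nabla\big)\mathbf u\cdot\mathbf v-\int_\Omega\pi\,\mathrm{div}\,\mathbf v-\int_\Omega\mathbf g\cdot\mathbf v-\int_\Omega T\,\mathbf e_g\cdot\mathbf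 v\\&+\int_\Omega q\,\mathrm{div}\,\mathbf u.\end{aligned}$$ Then all these integrals are well defined, $\mathcal F$ maps $X$ into $Y'$, and $\mathcal F:X\to Y'$ is Fréchet differentiable. Its derivative $D\mathcal F(U)\in\mathcal L(X,Y')$ is given, for $(\chi,\Theta,\mathbf w,r)\in X$ and $(\psi,\varphi,\mathbf v,q)\in Y$, with $\partial\mathbf j=-\nabla\chi-h'(\phi)\chi\nabla T-h(\phi)\nabla\Theta$, by $$\begin{aligned}\langle D\mathcal F(U)(\chi,\Theta,\mathbf w,r),(\psi,\varphi,\mathbf v,q)\rangle={}&\int_\Omega\nabla\chi\cdot\nabla\psi+\int_\Omega h'(\phi)\chi\nabla T\cdot\nabla\psi+\int_\Omega h(\phi)\nabla\Theta\cdot\nabla\psi+\int_\Omega\mathbf u\cdot\nabla\chi\,\psi+\int_\Omega\mathbf w\cdot\nabla\phi\,\psi\\&+\int_\Omega\nabla(k(\phi)\Theta)\cdot\nabla\varphi+\int_\Omega k'(\phi)(\chi\nabla T-\Theta\nabla\phi)\cdot\nabla\varphi\\&+\int_\Omega(\partial\mathbf j+\chi\mathbf u+\eta\mathbf w)\cdot\nabla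 T\,\varphi+\int_\Omega(\mathbf j+\eta\mathbf u)\cdot\nabla\Theta\,\varphi\\&+\int_\Omega\tfrac{\mu(\phi)}2D(\mathbf w):D(\mathbf v)+\int_\Omega\tfrac{\mu'(\phi)}2\chi\,D(\mathbf u):D(\mathbf v)\\&+\int_\Omega\big((\partial\mathbf j+\chi\mathbf u+\rho\mathbf w)\cdot\nabla\big)\mathbf u\cdot\mathbf v+\int_\Omega\big((\mathbf j+\rho\mathbf u)\cdot\nabla\big)\mathbf w\cdot\mathbf v\\&-\int_\Omega r\,\mathrm{div}\,\mathbf v-\int_\Omega\Theta\,\mathbf e_g\cdot\mathbf v+\int_\Omega q\,\mathrm{div}\,\mathbf w,\end{aligned}$$ where all integrals are again well defined. Moreover, $D\mathcal F$ is locally Lipschitz continuous: for every $U\in X$ and $r_0>0$ there is $L=L(U,r_0)\ge0$ such that $$\|D\mathcal F(U)-D\mathcal F(V)\|_{\mathcal L(X,Y')}\le L\,\|U-V\|_X\qquad\text{for all }V\in X\text{ with }\|U-V\|_X<r_0.$$ -/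

import Mathlib

open MeasureTheory Set
open scoped ENNReal ContDiff Topology RealInnerProductSpace

noncomputable section

namespace Nanofluid

/-- Euclidean space `ℝ^d`. -/
abbrev E (d : ℕ) : Type := EuclideanSpace ℝ (Fin d)

/-- `Ω` has a boundary of class `C²`: near each boundary point, `Ω` is the sublevel set of a `C²`
function with non-vanishing differential. -/
def HasC2Boundary {d : ℕ} (Ω : Set (E d)) : Prop :=
  ∀ x ∈ frontier Ω, ∃ N ∈ 𝓝 x, ∃ ρ : E d → ℝ,
    ContDiff ℝ 2 ρ ∧ fderiv ℝ ρ x ≠ 0 ∧ Ω ∩ N = {y ∈ N | ρ y < 0}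

/-- A bounded domain of class `C²`. -/
structure IsC2Domain {d : ℕ} (Ω : Set (E d)) : Prop where
  isOpen : IsOpen Ω
  isConnected : IsConnected Ω
  isBounded : Bornology.IsBounded Ω
  hasC2Boundary : HasC2Boundary Ω

/-! ### Weak gradients and Sobolev spaces -/

/-- `ζ ∈ C₀^∞(Ω)`. -/
structure IsTest {d : ℕ} (Ω : Set (E d)) (ζ : E d → ℝ) : Prop where
  contDiff : ContDiff ℝ ∞ ζ
  hasCompactSupport : HasCompactSupport ζ
  tsupport_subset : tsupport ζ ⊆ Ω

/-- The partial derivative `∂ᵢ ζ (x)`. -/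
def partialDeriv {d : ℕ} (i : Fin d) (ζ : E d → ℝ) (x : E d) : ℝ :=
  fderiv ℝ ζ x (EuclideanSpace.single i 1)

/-- `G` is the weak (distributional) gradient of `u` in `Ω`. -/
structure HasWeakGrad {d : ℕ} (Ω : Set (E d)) (u : E d → ℝ) (G : E d → E d) : Prop where
  locallyIntegrableOn : LocallyIntegrableOn u Ω
  locallyIntegrableOn_grad : LocallyIntegrableOn G Ω
  integral_eq : ∀ ζ : E d → ℝ, IsTest Ω ζ → ∀ i : Fin d,
    ∫ x in Ω, u x * partialDeriv i ζ x = - ∫ x in Ω, G x i * ζ x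

open Classical in
/-- The weak gradient of `u` in `Ω` (determined up to a null set), `0` if there is none. -/
def weakGrad {d : ℕ} (Ω : Set (E d)) (u : E d → ℝ) : E d → E d :=
  if h : ∃ G : E d → E d, HasWeakGrad Ω u G then h.choose else 0

/-- `L_p(Ω)` -/
abbrev LpR {d : ℕ} (Ω : Set (E d)) (p : ℝ≥0∞) : Type := Lp ℝ p (volume.restrict Ω)

/-- `L_p(Ω)^d` -/
abbrev LpE {d : ℕ} (Ω : Set (E d)) (p : ℝ≥0∞) : Type := Lp (E d) p (volume.restrict Ω)

theorem IsTest.integrable_mul {d : ℕ} {Ω : Set (E d)} {ζ : E d → ℝ} (hζ : IsTest Ω ζ)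
    {u : E d → ℝ} (hu : LocallyIntegrable u (volume.restrict Ω)) :
    Integrable (fun x => u x * ζ x) (volume.restrict Ω) := by
  simpa [smul_eq_mul, mul_comm] using
    hu.integrable_smul_left_of_hasCompactSupport hζ.contDiff.continuous hζ.hasCompactSupport

theorem IsTest.partialDeriv {d : ℕ} {Ω : Set (E d)} {ζ : E d → ℝ} (hζ : IsTest Ω ζ)
    (i : Fin d) : IsTest Ω (partialDeriv i ζ) where
  contDiff := (hζ.contDiff.fderiv_right (m := ∞) (by simp)).clm_apply contDiff_const
  hasCompactSupport := hζ.hasCompactSupport.fderiv_apply (𝕜 := ℝ) _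
  tsupport_subset := (tsupport_fderiv_apply_subset ℝ _).trans hζ.tsupport_subset

theorem LpR.locallyIntegrable {d : ℕ} {Ω : Set (E d)} {p : ℝ≥0∞} [hp : Fact (1 ≤ p)]
    (u : LpR Ω p) : LocallyIntegrable u (volume.restrict Ω) :=
  (Lp.memLp u).locallyIntegrable hp.out

theorem LpE.locallyIntegrable {d : ℕ} {Ω : Set (E d)} {p : ℝ≥0∞} [hp : Fact (1 ≤ p)]
    (u : LpE Ω p) : LocallyIntegrable u (volume.restrict Ω) :=
  (Lp.memLp u).locallyIntegrable hp.out

theorem LpE.locallyIntegrable_coord {d : ℕ} {Ω : Set (E d)} {p : ℝ≥0∞} [hp : Fact (1 ≤ p)]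
    (u : LpE Ω p) (i : Fin d) : LocallyIntegrable (fun x => u x i) (volume.restrict Ω) :=
  ((Lp.memLp u).eval_piLp i).locallyIntegrable hp.out

theorem locallyIntegrableOn_of_restrict {d : ℕ} {Ω : Set (E d)} {F : Type*} [NormedAddCommGroup F]
    {u : E d → F} (hu : LocallyIntegrable u (volume.restrict Ω)) :
    LocallyIntegrableOn u Ω := by
  intro x _
  obtain ⟨s, hs, hi⟩ := hu x
  obtain ⟨t, hts, hto, hxt⟩ := mem_nhds_iff.1 hs
  refine ⟨t ∩ Ω, Filter.inter_mem (mem_nhdsWithin_of_mem_nhds (hto.mem_nhds hxt))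
    self_mem_nhdsWithin, ?_⟩
  have := hi.mono_set hts
  rwa [IntegrableOn, Measure.restrict_restrict hto.measurableSet] at this

/-- The Sobolev space `W^1_p(Ω)`: the pairs `(u, ∇u)` in `L_p(Ω) × L_p(Ω)^d` where `∇u` is the weak
gradient of `u`, with the norm `(‖u‖_p^p + ‖∇u‖_p^p)^(1/p)`. -/
def sobolev {d : ℕ} (Ω : Set (E d)) (p : ℝ≥0∞) [Fact (1 ≤ p)] :
    Submodule ℝ (WithLp p (LpR Ω p × LpE Ω p)) where
  carrier := {w | HasWeakGrad Ω w.fst w.snd}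
  zero_mem' := by
    refine ⟨locallyIntegrableOn_of_restrict (LpR.locallyIntegrable _),
      locallyIntegrableOn_of_restrict (LpE.locallyIntegrable _), fun ζ _ i => ?_⟩
    have h1 : ∫ x in Ω, (0 : LpR Ω p) x * partialDeriv i ζ x = 0 := by
      refine integral_eq_zero_of_ae ?_
      filter_upwards [Lp.coeFn_zero ℝ p (volume.restrict Ω)] with x hx
      rw [hx]
      simp
    have h2 : ∫ x in Ω, (0 : LpE Ω p) x i * ζ x = 0 := by
      refine integral_eq_zero_of_ae ?_
      filter_upwards [Lp.coeFn_zero (E d) p (volume.restrict Ω)] with x hx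
      rw [hx]
      simp
    change ∫ x in Ω, (0 : LpR Ω p) x * partialDeriv i ζ x = - ∫ x in Ω, (0 : LpE Ω p) x i * ζ x
    rw [h1, h2, neg_zero]
  add_mem' := by
    intro v w hv hw
    refine ⟨locallyIntegrableOn_of_restrict (LpR.locallyIntegrable _),
      locallyIntegrableOn_of_restrict (LpE.locallyIntegrable _), fun ζ hζ i => ?_⟩
    have h1 : ∫ x in Ω, (v + w).fst x * partialDeriv i ζ x
        = ∫ x in Ω, (v.fst x * partialDeriv i ζ x + w.fst x * partialDeriv i ζ x) := by
      refine integral_congr_ae ?_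
      filter_upwards [Lp.coeFn_add v.fst w.fst] with x hx
      rw [WithLp.add_fst, hx, Pi.add_apply, add_mul]
    have h2 : ∫ x in Ω, (v + w).snd x i * ζ x
        = ∫ x in Ω, (v.snd x i * ζ x + w.snd x i * ζ x) := by
      refine integral_congr_ae ?_
      filter_upwards [Lp.coeFn_add v.snd w.snd] with x hx
      rw [WithLp.add_snd, hx, Pi.add_apply, PiLp.add_apply, add_mul]
    rw [h1, h2, integral_add ((hζ.partialDeriv i).integrable_mul (LpR.locallyIntegrable _))
      ((hζ.partialDeriv i).integrable_mul (LpR.locallyIntegrable _)),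
      integral_add (hζ.integrable_mul (LpE.locallyIntegrable_coord _ i))
      (hζ.integrable_mul (LpE.locallyIntegrable_coord _ i)),
      hv.integral_eq ζ hζ i, hw.integral_eq ζ hζ i]
    ring
  smul_mem' := by
    intro c w hw
    refine ⟨locallyIntegrableOn_of_restrict (LpR.locallyIntegrable _),
      locallyIntegrableOn_of_restrict (LpE.locallyIntegrable _), fun ζ hζ i => ?_⟩
    have h1 : ∫ x in Ω, (c • w).fst x * partialDeriv i ζ x
        = ∫ x in Ω, c * (w.fst x * partialDeriv i ζ x) := by
      refine integral_congr_ae ?_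
      filter_upwards [Lp.coeFn_smul c w.fst] with x hx
      rw [WithLp.smul_fst, hx, Pi.smul_apply, smul_eq_mul, mul_assoc]
    have h2 : ∫ x in Ω, (c • w).snd x i * ζ x = ∫ x in Ω, c * (w.snd x i * ζ x) := by
      refine integral_congr_ae ?_
      filter_upwards [Lp.coeFn_smul c w.snd] with x hx
      rw [WithLp.smul_snd, hx, Pi.smul_apply, PiLp.smul_apply, smul_eq_mul, mul_assoc]
    rw [h1, h2, integral_const_mul, integral_const_mul, hw.integral_eq ζ hζ i, mul_neg]

/-- `W^1_p(Ω)` as a normed space. -/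
abbrev Sobolev {d : ℕ} (Ω : Set (E d)) (p : ℝ≥0∞) [Fact (1 ≤ p)] : Type := sobolev Ω p

/-- The function `u`, for `u ∈ W^1_p(Ω)`. -/
def Sobolev.fn {d : ℕ} {Ω : Set (E d)} {p : ℝ≥0∞} [Fact (1 ≤ p)] (u : Sobolev Ω p) : E d → ℝ :=
  u.1.fst

/-- The gradient `∇u`, for `u ∈ W^1_p(Ω)`. -/
def Sobolev.grad {d : ℕ} {Ω : Set (E d)} {p : ℝ≥0∞} [Fact (1 ≤ p)] (u : Sobolev Ω p) :
    E d → E d :=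
  u.1.snd

/-- The image of `C₀^∞(Ω)` in `W^1_p(Ω)`. -/
def testFunctions {d : ℕ} (Ω : Set (E d)) (p : ℝ≥0∞) [Fact (1 ≤ p)] :
    Submodule ℝ (Sobolev Ω p) where
  carrier := {u | ∃ ζ : E d → ℝ, IsTest Ω ζ ∧ u.fn =ᵐ[volume.restrict Ω] ζ}
  zero_mem' :=
    ⟨0, ⟨contDiff_const, HasCompactSupport.zero, by simp [tsupport]⟩,
      Lp.coeFn_zero ℝ p (volume.restrict Ω)⟩
  add_mem' := by
    rintro u v ⟨ζ, hζ, hu⟩ ⟨ξ, hξ, hv⟩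
    exact ⟨ζ + ξ, ⟨hζ.contDiff.add hξ.contDiff, hζ.hasCompactSupport.add hξ.hasCompactSupport,
      (tsupport_add ζ ξ).trans (union_subset hζ.tsupport_subset hξ.tsupport_subset)⟩,
      (Lp.coeFn_add u.1.fst v.1.fst).trans (hu.add hv)⟩
  smul_mem' := by
    rintro c u ⟨ζ, hζ, hu⟩
    exact ⟨c • ζ, ⟨hζ.contDiff.const_smul c, hζ.hasCompactSupport.smul_left (f := fun _ => c),
      (tsupport_smul_subset_right (fun _ => c) ζ).trans hζ.tsupport_subset⟩,
      (Lp.coeFn_smul c u.1.fst).trans (hu.const_smul c)⟩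

/-- `W^1_p(Ω)` with zero boundary values: the closure of `C₀^∞(Ω)` in `W^1_p(Ω)`. -/
def Sobolev0 {d : ℕ} (Ω : Set (E d)) (p : ℝ≥0∞) [Fact (1 ≤ p)] : Type :=
  (testFunctions Ω p).topologicalClosure

instance {d : ℕ} (Ω : Set (E d)) (p : ℝ≥0∞) [Fact (1 ≤ p)] :
    NormedAddCommGroup (Sobolev0 Ω p) :=
  inferInstanceAs (NormedAddCommGroup (testFunctions Ω p).topologicalClosure)

instance {d : ℕ} (Ω : Set (E d)) (p : ℝ≥0∞) [Fact (1 ≤ p)] : NormedSpace ℝ (Sobolev0 Ω p) :=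
  inferInstanceAs (NormedSpace ℝ (testFunctions Ω p).topologicalClosure)

/-- The inclusion into `W^1_p(Ω)`. -/
def Sobolev0.toSobolev {d : ℕ} {Ω : Set (E d)} {p : ℝ≥0∞} [Fact (1 ≤ p)] (u : Sobolev0 Ω p) :
    Sobolev Ω p :=
  Subtype.val u

/-- The function `u`, for `u` in the closure of `C₀^∞(Ω)` in `W^1_p(Ω)`. -/
def Sobolev0.fn {d : ℕ} {Ω : Set (E d)} {p : ℝ≥0∞} [Fact (1 ≤ p)] (u : Sobolev0 Ω p) :
    E d → ℝ :=
  u.toSobolev.fn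

/-- The gradient `∇u`, for `u` in the closure of `C₀^∞(Ω)` in `W^1_p(Ω)`. -/
def Sobolev0.grad {d : ℕ} {Ω : Set (E d)} {p : ℝ≥0∞} [Fact (1 ≤ p)] (u : Sobolev0 Ω p) :
    E d → E d :=
  u.toSobolev.grad

/-- `w` is the tuple of partial derivatives of `u`, all of them in `W^1_p(Ω)`. -/
def IsSobolevGrad {d : ℕ} {Ω : Set (E d)} {p : ℝ≥0∞} [Fact (1 ≤ p)] (u : Sobolev Ω p)
    (w : Fin d → Sobolev Ω p) : Prop :=
  ∀ i, ∀ᵐ x ∂volume.restrict Ω, (w i).fn x = u.grad x i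

/-- `u ∈ W^2_p(Ω)` and `Δu = 0`. -/
def IsW2Harmonic {d : ℕ} {Ω : Set (E d)} {p : ℝ≥0∞} [Fact (1 ≤ p)] (u : Sobolev Ω p) : Prop :=
  ∃ w : Fin d → Sobolev Ω p, IsSobolevGrad u w ∧
    ∀ᵐ x ∂volume.restrict Ω, ∑ i, (w i).grad x i = 0

/-! ### Velocities and pressures -/

/-- `H_0^{1,2}(Ω)^d`, with its Hilbert space norm. -/
def Velocity {d : ℕ} (Ω : Set (E d)) : Type := PiLp 2 (fun _ : Fin d => Sobolev0 Ω 2)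

instance {d : ℕ} (Ω : Set (E d)) : NormedAddCommGroup (Velocity Ω) :=
  inferInstanceAs (NormedAddCommGroup (PiLp 2 (fun _ : Fin d => Sobolev0 Ω 2)))

instance {d : ℕ} (Ω : Set (E d)) : NormedSpace ℝ (Velocity Ω) :=
  inferInstanceAs (NormedSpace ℝ (PiLp 2 (fun _ : Fin d => Sobolev0 Ω 2)))

/-- The component `uᵢ`. -/
def Velocity.comp {d : ℕ} {Ω : Set (E d)} (u : Velocity Ω) (i : Fin d) : Sobolev0 Ω 2 :=
  WithLp.ofLp u i

/-- The vector field `u`. -/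
def Velocity.fn {d : ℕ} {Ω : Set (E d)} (u : Velocity Ω) (x : E d) : E d :=
  WithLp.toLp 2 fun i => (u.comp i).fn x

/-- The matrix `D(u) = ∇u + ∇uᵀ`. -/
def Velocity.symGrad {d : ℕ} {Ω : Set (E d)} (u : Velocity Ω) (x : E d) :
    Matrix (Fin d) (Fin d) ℝ :=
  fun i j => (u.comp j).grad x i + (u.comp i).grad x j

/-- The divergence of `u`. -/
def Velocity.div {d : ℕ} {Ω : Set (E d)} (u : Velocity Ω) (x : E d) : ℝ :=
  ∑ i, (u.comp i).grad x i

/-- The directional derivative `a · ∇u`, with components `∑ⱼ aⱼ ∂ⱼ uᵢ`. -/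
def Velocity.convect {d : ℕ} {Ω : Set (E d)} (a : E d → E d) (u : Velocity Ω) (x : E d) : E d :=
  WithLp.toLp 2 fun i => ∑ j, a x j * (u.comp i).grad x j

/-- The matrix product `A : B = ∑ᵢⱼ AᵢⱼBᵢⱼ`. -/
def frob {d : ℕ} (A B : Matrix (Fin d) (Fin d) ℝ) : ℝ := ∑ i, ∑ j, A i j * B i j

/-- `L_{2,0}(Ω)`: the functions in `L_2(Ω)` with mean value zero. (On a bounded `Ω` all functions
in `L_2(Ω)` are integrable.) -/
def zeroMean {d : ℕ} (Ω : Set (E d)) : Submodule ℝ (LpR Ω 2) where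
  carrier := {q | Integrable q (volume.restrict Ω) ∧ ∫ x in Ω, q x = 0}
  zero_mem' := by
    have h := Lp.coeFn_zero ℝ 2 (volume.restrict Ω)
    exact ⟨(integrable_congr h).2 (integrable_zero _ _ _), by rw [integral_congr_ae h]; simp⟩
  add_mem' := by
    rintro q r ⟨hq, hq0⟩ ⟨hr, hr0⟩
    have h := Lp.coeFn_add q r
    refine ⟨(integrable_congr h).2 (hq.add hr), ?_⟩
    rw [integral_congr_ae h, integral_add' hq hr, hq0, hr0, add_zero]
  smul_mem' := by
    rintro c q ⟨hq, hq0⟩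
    have h := Lp.coeFn_smul c q
    refine ⟨(integrable_congr h).2 (hq.smul c), ?_⟩
    rw [integral_congr_ae h]
    simp [integral_const_mul, hq0]

/-- The space of pressures `L_{2,0}(Ω)`. -/
def Pressure {d : ℕ} (Ω : Set (E d)) : Type := zeroMean Ω

instance {d : ℕ} (Ω : Set (E d)) : NormedAddCommGroup (Pressure Ω) :=
  inferInstanceAs (NormedAddCommGroup (zeroMean Ω))

instance {d : ℕ} (Ω : Set (E d)) : NormedSpace ℝ (Pressure Ω) :=
  inferInstanceAs (NormedSpace ℝ (zeroMean Ω))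

/-- The pressure as a function. -/
def Pressure.fn {d : ℕ} {Ω : Set (E d)} (q : Pressure Ω) : E d → ℝ :=
  (Subtype.val q : LpR Ω 2)

/-- The product `W^1_p × W^1_p × H^1 × L_{2,0}` with zero boundary values in the first three
factors, normed by the maximum of the norms of the components. With the exponent `p` it is the
space of unknowns `X`, with the dual exponent it is the space of test functions `Y`. -/
abbrev Space {d : ℕ} (Ω : Set (E d)) (p : ℝ≥0∞) [Fact (1 ≤ p)] : Type :=
  Sobolev0 Ω p × Sobolev0 Ω p × Velocity Ω × Pressure Ω

/-! ### The system of equations -/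

/-- A function on `ℝ` which is bounded together with its first two derivatives. -/
def BoundedUpToOrderTwo (a : ℝ → ℝ) : Prop :=
  ∃ C : ℝ, ∀ l ≤ 2, ∀ s : ℝ, |iteratedDeriv l a s| ≤ C

/-- The data of the problem: the coefficients `h, k, μ` (extended from `[0,1]` to `ℝ`), the
boundary values `φ_D`, the right-hand sides `f, g` and the direction of gravity `e_g`. -/
structure Data {d : ℕ} (Ω : Set (E d)) (p : ℝ≥0∞) [Fact (1 ≤ p)] where
  h : ℝ → ℝ
  k : ℝ → ℝ
  μ : ℝ → ℝ
  φD : Sobolev Ω p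
  f : LpR Ω p
  g : LpE Ω 2
  eg : E d
  contDiff_h : ContDiff ℝ 2 h
  contDiff_k : ContDiff ℝ 2 k
  contDiff_μ : ContDiff ℝ 2 μ
  h_eq : ∀ s ∈ Icc (0 : ℝ) 1, h s = s * (1 - s)
  bounded_h : BoundedUpToOrderTwo h
  bounded_k : BoundedUpToOrderTwo k
  k_pos : ∃ k₀ > 0, ∀ s, k₀ ≤ k s
  μ_pos : ∃ μ₀ > 0, ∀ s, μ₀ ≤ μ s
  φD_harmonic : IsW2Harmonic φD
  φD_mem : ∀ᵐ x ∂volume.restrict Ω, φD.fn x ∈ Icc (0 : ℝ) 1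
  norm_eg : ‖eg‖ = 1

namespace Data

variable {d : ℕ} {Ω : Set (E d)} {p p' : ℝ≥0∞} [Fact (1 ≤ p)] [Fact (1 ≤ p')]

/-- `φ = φ_D + φ̃` -/
def phi (D : Data Ω p) (U : Space Ω p) : Sobolev Ω p := D.φD + U.1.toSobolev

/-- `j = -∇φ - h(φ)∇T` -/
def flux (D : Data Ω p) (U : Space Ω p) (x : E d) : E d :=
  -(D.phi U).grad x - D.h ((D.phi U).fn x) • U.2.1.grad x

/-- `∂j = -∇χ - h'(φ)χ∇T - h(φ)∇Θ`, where `W = (χ, Θ, w, r)` -/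
def fluxDeriv (D : Data Ω p) (U W : Space Ω p) (x : E d) : E d :=
  -W.1.grad x - (deriv D.h ((D.phi U).fn x) * W.1.fn x) • U.2.1.grad x
    - D.h ((D.phi U).fn x) • W.2.1.grad x

/-- The integrands of `⟨F(U), V⟩`, where `U = (φ̃, T, u, π)` and `V = (ψ, ϕ, v, q)`; here
`η = ρ = 1 + φ`. -/
def terms (D : Data Ω p) (U : Space Ω p) (V : Space Ω p') : Fin 12 → E d → ℝ :=
  let φ := D.phi U
  let T := U.2.1
  let u := U.2.2.1
  let π := U.2.2.2
  let ψ := V.1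
  let ϕ := V.2.1
  let v := V.2.2.1
  let q := V.2.2.2
  let j := D.flux U
  let η : E d → ℝ := fun x => 1 + φ.fn x
  let ρ : E d → ℝ := fun x => 1 + φ.fn x
  ![fun x => ⟪φ.grad x, ψ.grad x⟫,
    fun x => D.h (φ.fn x) * ⟪T.grad x, ψ.grad x⟫,
    fun x => ⟪u.fn x, φ.grad x⟫ * ψ.fn x,
    fun x => D.k (φ.fn x) * ⟪T.grad x, ϕ.grad x⟫,
    fun x => ⟪j x + η x • u.fn x, T.grad x⟫ * ϕ.fn x,
    fun x => -(D.f x * ϕ.fn x),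
    fun x => D.μ (φ.fn x) / 2 * frob (u.symGrad x) (v.symGrad x),
    fun x => ⟪Velocity.convect (fun y => j y + ρ y • u.fn y) u x, v.fn x⟫,
    fun x => -(π.fn x * v.div x),
    fun x => -⟪D.g x, v.fn x⟫,
    fun x => -(T.fn x * ⟪D.eg, v.fn x⟫),
    fun x => q.fn x * u.div x]

/-- The integrands of `⟨DF(U)W, V⟩`, where `U = (φ̃, T, u, π)`, `W = (χ, Θ, w, r)` and
`V = (ψ, ϕ, v, q)`. -/
def derivTerms (D : Data Ω p) (U W : Space Ω p) (V : Space Ω p') : Fin 16 → E d → ℝ :=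
  let φ := D.phi U
  let T := U.2.1
  let u := U.2.2.1
  let χ := W.1
  let Θ := W.2.1
  let w := W.2.2.1
  let r := W.2.2.2
  let ψ := V.1
  let ϕ := V.2.1
  let v := V.2.2.1
  let q := V.2.2.2
  let j := D.flux U
  let dj := D.fluxDeriv U W
  let η : E d → ℝ := fun x => 1 + φ.fn x
  let ρ : E d → ℝ := fun x => 1 + φ.fn x
  ![fun x => ⟪χ.grad x, ψ.grad x⟫,
    fun x => deriv D.h (φ.fn x) * χ.fn x * ⟪T.grad x, ψ.grad x⟫,
    fun x => D.h (φ.fn x) * ⟪Θ.grad x, ψ.grad x⟫,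
    fun x => ⟪u.fn x, χ.grad x⟫ * ψ.fn x,
    fun x => ⟪w.fn x, φ.grad x⟫ * ψ.fn x,
    fun x => ⟪weakGrad Ω (fun y => D.k (φ.fn y) * Θ.fn y) x, ϕ.grad x⟫,
    fun x => deriv D.k (φ.fn x) * ⟪χ.fn x • T.grad x - Θ.fn x • φ.grad x, ϕ.grad x⟫,
    fun x => ⟪dj x + χ.fn x • u.fn x + η x • w.fn x, T.grad x⟫ * ϕ.fn x,
    fun x => ⟪j x + η x • u.fn x, Θ.grad x⟫ * ϕ.fn x,
    fun x => D.μ (φ.fn x) / 2 * frob (w.symGrad x) (v.symGrad x),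
    fun x => deriv D.μ (φ.fn x) / 2 * χ.fn x * frob (u.symGrad x) (v.symGrad x),
    fun x => ⟪Velocity.convect (fun y => dj y + χ.fn y • u.fn y + ρ y • w.fn y) u x, v.fn x⟫,
    fun x => ⟪Velocity.convect (fun y => j y + ρ y • u.fn y) w x, v.fn x⟫,
    fun x => -(r.fn x * v.div x),
    fun x => -(Θ.fn x * ⟪D.eg, v.fn x⟫),
    fun x => q.fn x * w.div x]

/-- `⟨F(U), V⟩` -/
def form (D : Data Ω p) (U : Space Ω p) (V : Space Ω p') : ℝ :=
  ∑ i, ∫ x in Ω, D.terms U V i x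

/-- `⟨DF(U)W, V⟩` -/
def derivForm (D : Data Ω p) (U W : Space Ω p) (V : Space Ω p') : ℝ :=
  ∑ i, ∫ x in Ω, D.derivTerms U W V i x

end Data

end Nanofluid

end

/-!
The form is a finite sum of integrals `∫ a(U) b(V)`, in which `b` is linear and bounded from the
test space into some `L_s(Ω)` and `a` is a map from the unknowns into the dual space `L_m(Ω)`. Such
a pairing is as smooth in `U`, with values in the dual of the test space, as `a` is, so everything
reduces to the smoothness of maps into Lebesgue spaces. The property used is `HasLipDeriv`:
differentiability with a derivative that is Lipschitz on every ball. It is preserved by continuous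
bilinear maps (Hölder's inequality, `SmoothInLp.mul`) and by compositions.

* Since `p > 3 ≥ d`, Morrey's inequality (`exists_morrey_bound`) embeds the space of `φ̃` into
  `L_∞`. On `L_∞` the superposition operator `φ ↦ h(φ)` of a `C²` function is differentiable with
  derivative `χ ↦ h'(φ)χ`, by Taylor's formula (`hasLipDeriv_nemytskii`). So the coefficients
  `h(φ), k(φ), μ(φ)` are smooth maps into `L_∞`.
* The Gagliardo-Nirenberg-Sobolev inequality (`linearInLp_sobolev`) gives `u, v ∈ L_6`. Hence
  `j + ρu ∈ L_3`, and the products `(j + ρu) · ∇T` and `((j + ρu) · ∇)u` are in `L_m` with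
  `1/m = 1/3 + 1/p` and in `L_{6/5}`. The second is paired with `v ∈ L_6`; the exponent dual to the
  first is the Sobolev exponent of `p'` in dimension three, so it is paired with `ψ, ϕ ∈ L_s`
  (`exists_exponents`).
* The derivative of `k(φ)∇T` is `k'(φ)χ∇T + k(φ)∇Θ`. The form of it in the statement contains
  the weak gradient of `k(φ)Θ`, which exists and equals `k(φ)∇Θ + k'(φ)Θ∇φ`: the chain rule for `k(φ)`
  is shown by mollification (`HasWeakGrad.comp`), the product rule by approximating `Θ` by test
  functions (`HasWeakGrad.mul_sobolev0`).

Both embeddings are inequalities for test functions, extended to their closure by Fatou's lemma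
(`linearInLp_fn_of_test`).
-/

noncomputable section

namespace Nanofluid

/-! ### Maps with a locally Lipschitz derivative -/

section Abstract

variable {X Y Z Z₁ Z₂ : Type*} [NormedAddCommGroup X] [NormedSpace ℝ X]
  [NormedAddCommGroup Y] [NormedSpace ℝ Y] [NormedAddCommGroup Z] [NormedSpace ℝ Z]
  [NormedAddCommGroup Z₁] [NormedSpace ℝ Z₁] [NormedAddCommGroup Z₂] [NormedSpace ℝ Z₂]

/-- A continuous bilinear map of two bounded Lipschitz maps on a ball is Lipschitz. -/
theorem lipschitz_bilin {W : Type*} [NormedAddCommGroup W] (B : Z₁ →L[ℝ] Z₂ →L[ℝ] Z) {a : W → Z₁}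
    {b : W → Z₂} {R Ca La Cb Lb : ℝ} (ha : ∀ U, ‖U‖ ≤ R → ‖a U‖ ≤ Ca)
    (hb : ∀ U, ‖U‖ ≤ R → ‖b U‖ ≤ Cb)
    (hCa : 0 ≤ Ca) (hLa : 0 ≤ La) (hCb : 0 ≤ Cb) (hLb : 0 ≤ Lb)
    (hla : ∀ U V, ‖U‖ ≤ R → ‖V‖ ≤ R → ‖a U - a V‖ ≤ La * ‖U - V‖)
    (hlb : ∀ U V, ‖U‖ ≤ R → ‖V‖ ≤ R → ‖b U - b V‖ ≤ Lb * ‖U - V‖) :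
    ∃ L : ℝ, 0 ≤ L ∧ ∀ U V, ‖U‖ ≤ R → ‖V‖ ≤ R →
      ‖B (a U) (b U) - B (a V) (b V)‖ ≤ L * ‖U - V‖ := by
  refine ⟨‖B‖ * (Ca * Lb + La * Cb), by positivity, fun U V hU hV => ?_⟩
  calc ‖B (a U) (b U) - B (a V) (b V)‖ = ‖B (a U) (b U - b V) + B (a U - a V) (b V)‖ := by
        congr 1
        simp only [map_sub, sub_apply]
        abel
    _ ≤ ‖B‖ * ‖a U‖ * ‖b U - b V‖ + ‖B‖ * ‖a U - a V‖ * ‖b V‖ :=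
        (norm_add_le _ _).trans (add_le_add (B.le_opNorm₂ _ _) (B.le_opNorm₂ _ _))
    _ ≤ ‖B‖ * Ca * (Lb * ‖U - V‖) + ‖B‖ * (La * ‖U - V‖) * Cb := by
        gcongr
        exacts [ha U hU, hlb U V hU hV, hla U V hU hV, hb V hV]
    _ = _ := by ring

/-- `f` is Fréchet differentiable with derivative `f'`, and `f'` is Lipschitz continuous on every
ball (not merely near every point, which is weaker in infinite dimensions). -/
structure HasLipDeriv (f : X → Z) (f' : X → X →L[ℝ] Z) : Prop where
  hasFDerivAt : ∀ U, HasFDerivAt f (f' U) U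
  lip : ∀ R : ℝ, ∃ L : ℝ, 0 ≤ L ∧ ∀ U V, ‖U‖ ≤ R → ‖V‖ ≤ R → ‖f' U - f' V‖ ≤ L * ‖U - V‖

namespace HasLipDeriv

theorem deriv_bounded {f : X → Z} {f' : X → X →L[ℝ] Z} (hf : HasLipDeriv f f') (R : ℝ) :
    ∃ C : ℝ, 0 ≤ C ∧ ∀ U, ‖U‖ ≤ R → ‖f' U‖ ≤ C := by
  obtain ⟨L, hL, h⟩ := hf.lip (max R 0)
  refine ⟨L * max R 0 + ‖f' 0‖, by positivity, fun U hU => ?_⟩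
  have h1 := h U 0 (hU.trans (le_max_left _ _)) (by simp)
  have h2 : ‖f' U‖ ≤ ‖f' U - f' 0‖ + ‖f' 0‖ := norm_le_norm_sub_add _ _
  rw [sub_zero] at h1
  have h3 : L * ‖U‖ ≤ L * max R 0 := by gcongr; exact hU.trans (le_max_left _ _)
  linarith

theorem lipschitz {f : X → Z} {f' : X → X →L[ℝ] Z} (hf : HasLipDeriv f f') (R : ℝ) :
    ∃ C : ℝ, 0 ≤ C ∧ ∀ U V, ‖U‖ ≤ R → ‖V‖ ≤ R → ‖f U - f V‖ ≤ C * ‖U - V‖ := by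
  obtain ⟨C, hC, h⟩ := hf.deriv_bounded R
  refine ⟨C, hC, fun U V hU hV => ?_⟩
  refine (convex_closedBall (0 : X) R).norm_image_sub_le_of_norm_hasFDerivWithin_le
    (fun x _ => (hf.hasFDerivAt x).hasFDerivWithinAt) (fun x hx => h x ?_) ?_ ?_
  all_goals simp_all

theorem bounded {f : X → Z} {f' : X → X →L[ℝ] Z} (hf : HasLipDeriv f f') (R : ℝ) :
    ∃ C : ℝ, 0 ≤ C ∧ ∀ U, ‖U‖ ≤ R → ‖f U‖ ≤ C := by
  obtain ⟨L, hL, h⟩ := hf.lipschitz (max R 0)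
  refine ⟨L * max R 0 + ‖f 0‖, by positivity, fun U hU => ?_⟩
  have h1 := h U 0 (hU.trans (le_max_left _ _)) (by simp)
  have h2 : ‖f U‖ ≤ ‖f U - f 0‖ + ‖f 0‖ := norm_le_norm_sub_add _ _
  rw [sub_zero] at h1
  have h3 : L * ‖U‖ ≤ L * max R 0 := by gcongr; exact hU.trans (le_max_left _ _)
  linarith

theorem const (c : Z) : HasLipDeriv (fun _ : X => c) fun _ => 0 :=
  ⟨fun U => hasFDerivAt_const c U, fun _ => ⟨0, le_rfl, by simp⟩⟩

theorem clm (A : X →L[ℝ] Z) : HasLipDeriv A fun _ => A :=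
  ⟨fun _ => A.hasFDerivAt, fun _ => ⟨0, le_rfl, by simp⟩⟩

theorem add {f g : X → Z} {f' g' : X → X →L[ℝ] Z} (hf : HasLipDeriv f f')
    (hg : HasLipDeriv g g') : HasLipDeriv (fun U => f U + g U) fun U => f' U + g' U := by
  refine ⟨fun U => (hf.hasFDerivAt U).fun_add (hg.hasFDerivAt U), fun R => ?_⟩
  obtain ⟨L, hL, h⟩ := hf.lip R
  obtain ⟨M, hM, k⟩ := hg.lip R
  refine ⟨L + M, by positivity, fun U V hU hV => ?_⟩
  have h1 := h U V hU hV
  have h2 := k U V hU hV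
  calc _ = ‖(f' U - f' V) + (g' U - g' V)‖ := by congr 1; abel
    _ ≤ ‖f' U - f' V‖ + ‖g' U - g' V‖ := norm_add_le _ _
    _ ≤ _ := by linarith

/-- The product rule for a continuous bilinear map. -/
theorem bilin (B : Z₁ →L[ℝ] Z₂ →L[ℝ] Z) {f : X → Z₁} {g : X → Z₂} {f' : X → X →L[ℝ] Z₁}
    {g' : X → X →L[ℝ] Z₂} (hf : HasLipDeriv f f') (hg : HasLipDeriv g g') :
    HasLipDeriv (fun U => B (f U) (g U))
      fun U => B.precompR X (f U) (g' U) + B.precompL X (f' U) (g U) := by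
  refine ⟨fun U => B.hasFDerivAt_of_bilinear (hf.hasFDerivAt U) (hg.hasFDerivAt U), fun R => ?_⟩
  obtain ⟨C₁, hC₁, b₁⟩ := hf.bounded R
  obtain ⟨C₂, hC₂, b₂⟩ := hg.bounded R
  obtain ⟨L₁, hL₁, l₁⟩ := hf.lipschitz R
  obtain ⟨L₂, hL₂, l₂⟩ := hg.lipschitz R
  obtain ⟨C₃, hC₃, b₃⟩ := hf.deriv_bounded R
  obtain ⟨C₄, hC₄, b₄⟩ := hg.deriv_bounded R
  obtain ⟨L₃, hL₃, l₃⟩ := hf.lip R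
  obtain ⟨L₄, hL₄, l₄⟩ := hg.lip R
  obtain ⟨K, hK, h1⟩ := lipschitz_bilin (B.precompR X) b₁ b₄ hC₁ hL₁ hC₄ hL₄ l₁ l₄
  obtain ⟨M, hM, h2⟩ := lipschitz_bilin (B.precompL X) b₃ b₂ hC₃ hL₃ hC₂ hL₂ l₃ l₂
  refine ⟨K + M, by positivity, fun U V hU hV => ?_⟩
  calc _ = ‖(B.precompR X (f U) (g' U) - B.precompR X (f V) (g' V)) +
        (B.precompL X (f' U) (g U) - B.precompL X (f' V) (g V))‖ := by congr 1; abel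
    _ ≤ _ := norm_add_le _ _
    _ ≤ _ := add_le_add (h1 U V hU hV) (h2 U V hU hV)
    _ = _ := (add_mul _ _ _).symm

/-- The chain rule. -/
theorem comp {g : Z₁ → Z} {g' : Z₁ → Z₁ →L[ℝ] Z} {f : X → Z₁} {f' : X → X →L[ℝ] Z₁}
    (hg : HasLipDeriv g g') (hf : HasLipDeriv f f') :
    HasLipDeriv (fun U => g (f U)) fun U => (g' (f U)).comp (f' U) := by
  refine ⟨fun U => (hg.hasFDerivAt (f U)).comp U (hf.hasFDerivAt U), fun R => ?_⟩
  obtain ⟨C₁, hC₁, b₁⟩ := hf.bounded R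
  obtain ⟨L₁, hL₁, l₁⟩ := hf.lipschitz R
  obtain ⟨C₃, hC₃, b₃⟩ := hf.deriv_bounded R
  obtain ⟨L₃, hL₃, l₃⟩ := hf.lip R
  obtain ⟨C₄, hC₄, b₄⟩ := hg.deriv_bounded C₁
  obtain ⟨L₄, hL₄, l₄⟩ := hg.lip C₁
  refine ⟨C₄ * L₃ + L₄ * L₁ * C₃, by positivity, fun U V hU hV => ?_⟩
  calc _ = ‖(g' (f U)).comp (f' U - f' V) + (g' (f U) - g' (f V)).comp (f' V)‖ := by
        congr 1
        ext x
        simp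
    _ ≤ ‖g' (f U)‖ * ‖f' U - f' V‖ + ‖g' (f U) - g' (f V)‖ * ‖f' V‖ :=
        (norm_add_le _ _).trans (add_le_add (ContinuousLinearMap.opNorm_comp_le _ _)
          (ContinuousLinearMap.opNorm_comp_le _ _))
    _ ≤ C₄ * (L₃ * ‖U - V‖) + (L₄ * (L₁ * ‖U - V‖)) * C₃ := by
        gcongr
        · exact b₄ _ (b₁ U hU)
        · exact l₃ U V hU hV
        · refine (l₄ _ _ (b₁ U hU) (b₁ V hV)).trans ?_
          gcongr
          exact l₁ U V hU hV
        · exact b₃ V hV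
    _ = _ := by ring

theorem clm_comp (A : Z₁ →L[ℝ] Z) {f : X → Z₁} {f' : X → X →L[ℝ] Z₁} (hf : HasLipDeriv f f') :
    HasLipDeriv (fun U => A (f U)) fun U => A.comp (f' U) :=
  (clm A).comp hf

end HasLipDeriv

end Abstract

/-! ### Superposition operators on `L_∞` -/

section Nemytskii

variable {α : Type*} [MeasurableSpace α] {μ : Measure α}

/-- A Taylor estimate on bounded intervals. -/
theorem exists_taylor_bound {a : ℝ → ℝ} (ha : ContDiff ℝ 2 a) (R : ℝ) :
    ∃ L : ℝ, 0 ≤ L ∧ (∀ s t, |s| ≤ R → |t| ≤ R → |deriv a s - deriv a t| ≤ L * |s - t|) ∧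
      ∀ s t, |s| ≤ R → |t| ≤ R → |a t - a s - deriv a s * (t - s)| ≤ L * |t - s| ^ 2 := by
  have h1 : ContDiff ℝ 1 (deriv a) := ((contDiff_succ_iff_deriv (n := 1)).1 ha).2.2
  have h2 : Continuous (deriv (deriv a)) := h1.continuous_deriv le_rfl
  obtain ⟨L, hL⟩ := (isCompact_Icc (a := -R) (b := R)).exists_bound_of_continuousOn h2.continuousOn
  have hlip : ∀ s t, |s| ≤ R → |t| ≤ R →
      |deriv a s - deriv a t| ≤ max L 0 * |s - t| := by
    intro s t hs ht
    refine (convex_Icc (-R) R).norm_image_sub_le_of_norm_deriv_le (𝕜 := ℝ) (f := deriv a)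
      (fun x _ => (h1.differentiable one_ne_zero) x)
      (fun x hx => (hL x hx).trans (le_max_left _ _)) (abs_le.1 ht) (abs_le.1 hs)
  refine ⟨max L 0, le_max_right _ _, hlip, fun s t hs ht => ?_⟩
  -- the derivative in `x` of the Taylor remainder is small on the segment from `s` to `t`
  have hd : ∀ x,
      HasDerivAt (fun x => a x - a s - deriv a s * (x - s)) (deriv a x - deriv a s) x := by
    intro x
    have := ((ha.differentiable two_ne_zero x).hasDerivAt.sub_const (a s)).fun_sub
      (((hasDerivAt_id x).sub_const s).const_mul (deriv a s))
    simpa using this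
  have := (convex_uIcc s t).norm_image_sub_le_of_norm_hasDerivWithin_le (C := max L 0 * |t - s|)
    (fun x _ => (hd x).hasDerivWithinAt) (fun x hx => ?_) left_mem_uIcc right_mem_uIcc
  · simpa [sq, mul_assoc] using this
  · have hx1 : |x| ≤ R := by
      have h3 : uIcc s t ⊆ Icc (-R) R := uIcc_subset_Icc (abs_le.1 hs) (abs_le.1 ht)
      exact abs_le.2 (h3 hx)
    refine (hlip x s hx1 hs).trans ?_
    refine mul_le_mul_of_nonneg_left ?_ (le_max_right _ _)
    exact abs_sub_left_of_mem_uIcc hx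

theorem ae_abs_le_norm (f : Lp ℝ ∞ μ) : ∀ᵐ x ∂μ, |f x| ≤ ‖f‖ := by
  filter_upwards [enorm_ae_le_eLpNormEssSup f μ] with x hx
  have h2 := Lp.eLpNorm_ne_top f
  rw [eLpNorm_exponent_top] at h2
  rw [Lp.norm_def, eLpNorm_exponent_top]
  simpa using ENNReal.toReal_mono h2 hx

theorem norm_le_of_ae_abs_le {f : Lp ℝ ∞ μ} {C : ℝ} (hC : 0 ≤ C) (h : ∀ᵐ x ∂μ, |f x| ≤ C) :
    ‖f‖ ≤ C := by
  rw [Lp.norm_def, eLpNorm_exponent_top]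
  exact ENNReal.toReal_le_of_le_ofReal hC (eLpNormEssSup_le_of_ae_bound h)

theorem memLp_comp {a : ℝ → ℝ} (ha : Continuous a) (f : Lp ℝ ∞ μ) :
    MemLp (fun x => a (f x)) ∞ μ := by
  obtain ⟨C, hC⟩ := (isCompact_Icc (a := -‖f‖) (b := ‖f‖)).exists_bound_of_continuousOn
    ha.continuousOn
  refine memLp_top_of_bound (ha.comp_aestronglyMeasurable (Lp.aestronglyMeasurable f)) C ?_
  filter_upwards [ae_abs_le_norm f] with x hx
  exact hC _ (abs_le.1 hx)

/-- The superposition operator `f ↦ a ∘ f` on `L_∞`. -/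
def nemytskii (a : ℝ → ℝ) (ha : Continuous a) (f : Lp ℝ ∞ μ) : Lp ℝ ∞ μ :=
  (memLp_comp ha f).toLp _

theorem coeFn_nemytskii (a : ℝ → ℝ) (ha : Continuous a) (f : Lp ℝ ∞ μ) :
    nemytskii a ha f =ᵐ[μ] fun x => a (f x) :=
  MemLp.coeFn_toLp _

/-- Multiplication `L_p × L_q → L_r` for Hölder exponents. -/
def mulL (μ : Measure α) (p q r : ℝ≥0∞) [Fact (1 ≤ p)] [Fact (1 ≤ q)] [Fact (1 ≤ r)]
    [ENNReal.HolderTriple p q r] : Lp ℝ p μ →L[ℝ] Lp ℝ q μ →L[ℝ] Lp ℝ r μ :=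
  (ContinuousLinearMap.mul ℝ ℝ).holderL μ p q r

theorem coeFn_mulL {p q r : ℝ≥0∞} [Fact (1 ≤ p)] [Fact (1 ≤ q)] [Fact (1 ≤ r)]
    [ENNReal.HolderTriple p q r] (f : Lp ℝ p μ) (g : Lp ℝ q μ) :
    mulL μ p q r f g =ᵐ[μ] fun x => f x * g x :=
  (ContinuousLinearMap.mul ℝ ℝ).coeFn_holder (r := r) f g

/-- On `L_∞` the superposition operator of a `C²` function is differentiable with locally Lipschitz
derivative, because its Taylor estimate holds uniformly on bounded intervals. -/
theorem hasLipDeriv_nemytskii {a : ℝ → ℝ} (ha : ContDiff ℝ 2 a) :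
    HasLipDeriv (nemytskii (μ := μ) a ha.continuous)
      fun f => mulL μ ∞ ∞ ∞ (nemytskii (deriv a) (ha.continuous_deriv one_le_two) f) := by
  constructor
  · intro f
    obtain ⟨L, hL, -, h⟩ := exists_taylor_bound ha (‖f‖ + 1)
    refine HasFDerivAt.of_isLittleO ?_
    have hb : ∀ᶠ g in 𝓝 f, ‖nemytskii (μ := μ) a ha.continuous g - nemytskii a ha.continuous f -
        mulL μ ∞ ∞ ∞ (nemytskii (deriv a) (ha.continuous_deriv one_le_two) f) (g - f)‖
        ≤ L * ‖‖g - f‖ ^ 2‖ := by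
      filter_upwards [Metric.ball_mem_nhds f one_pos] with g hg
      rw [norm_pow, norm_norm]
      refine norm_le_of_ae_abs_le (by positivity) ?_
      have hg1 : ‖g‖ ≤ ‖f‖ + 1 := by
        have := norm_le_norm_add_norm_sub' g f
        rw [mem_ball_iff_norm] at hg
        linarith
      filter_upwards [Lp.coeFn_sub (nemytskii a ha.continuous g - nemytskii a ha.continuous f)
          (mulL μ ∞ ∞ ∞ (nemytskii (deriv a) (ha.continuous_deriv one_le_two) f) (g - f)),
        Lp.coeFn_sub (nemytskii (μ := μ) a ha.continuous g) (nemytskii a ha.continuous f),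
        coeFn_mulL (r := ∞) (nemytskii (deriv a) (ha.continuous_deriv one_le_two) f) (g - f),
        coeFn_nemytskii a ha.continuous f, coeFn_nemytskii a ha.continuous g,
        coeFn_nemytskii (deriv a) (ha.continuous_deriv one_le_two) f, Lp.coeFn_sub g f,
        ae_abs_le_norm f, ae_abs_le_norm g, ae_abs_le_norm (g - f)] with x h1 h2 h3 h4 h5 h6 h7 h8
        h9 h10
      simp only [Pi.sub_apply] at h1 h2 h7
      rw [h1, h2, h3, h4, h5, h6, h7]
      refine (h _ _ (by linarith) (by linarith)).trans ?_
      rw [h7] at h10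
      gcongr
    refine (Asymptotics.IsBigO.of_bound L hb).trans_isLittleO ?_
    exact ((Asymptotics.isLittleO_pow_id one_lt_two).comp_tendsto
      (tendsto_norm_sub_self f)).norm_right.congr_right (fun g => by simp) |>.of_norm_right
  · intro R
    obtain ⟨L, hL, h, -⟩ := exists_taylor_bound ha R
    refine ⟨‖mulL μ ∞ ∞ ∞‖ * L, by positivity, fun f g hf hg => ?_⟩
    rw [← map_sub, mul_assoc]
    refine (ContinuousLinearMap.le_opNorm _ _).trans ?_
    gcongr
    refine norm_le_of_ae_abs_le (by positivity) ?_
    filter_upwards [Lp.coeFn_sub (nemytskii (μ := μ) (deriv a) (ha.continuous_deriv one_le_two) f)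
        (nemytskii (deriv a) (ha.continuous_deriv one_le_two) g),
      coeFn_nemytskii (deriv a) (ha.continuous_deriv one_le_two) f,
      coeFn_nemytskii (deriv a) (ha.continuous_deriv one_le_two) g, Lp.coeFn_sub f g,
      ae_abs_le_norm f, ae_abs_le_norm g, ae_abs_le_norm (f - g)] with x h1 h2 h3 h4 h5 h6 h7
    simp only [Pi.sub_apply] at h1 h4
    rw [h1, h2, h3]
    refine (h _ _ (by linarith) (by linarith)).trans ?_
    rw [h4] at h7
    gcongr

end Nemytskii

/-! ### Function-valued maps and forms -/

section Representatives

variable {X Y α : Type*} [NormedAddCommGroup X] [NormedSpace ℝ X]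
  [NormedAddCommGroup Y] [NormedSpace ℝ Y] [MeasurableSpace α] {μ : Measure α}

theorem rpow_measure_univ_ne_top [IsFiniteMeasure μ] {a b : ℝ≥0∞} (ha : 1 ≤ a) (hab : a ≤ b) :
    (μ univ) ^ (1 / a.toReal - 1 / b.toReal) ≠ ⊤ := by
  refine ENNReal.rpow_ne_top_of_nonneg ?_ (measure_ne_top μ _)
  rcases eq_or_ne b ⊤ with rfl | hb
  · simp
  · exact sub_nonneg.2 (one_div_le_one_div_of_le
      (ENNReal.toReal_pos (zero_lt_one.trans_le ha).ne' (ne_top_of_le_ne_top hb hab))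
      (ENNReal.toReal_mono hb hab))

/-- The function-valued map `e` is, up to null sets, a continuous linear map into `L_b`. -/
def LinearInLp (μ : Measure α) (b : ℝ≥0∞) [Fact (1 ≤ b)] (e : Y → α → ℝ) : Prop :=
  ∃ A : Y →L[ℝ] Lp ℝ b μ, ∀ V, A V =ᵐ[μ] e V

/-- The function-valued map `f` is, up to null sets, a differentiable map into `L_a` whose
derivative is Lipschitz continuous on balls and is given by `f'`. -/
def SmoothInLp (μ : Measure α) (a : ℝ≥0∞) [Fact (1 ≤ a)] (f : X → α → ℝ) (f' : X → X → α → ℝ) :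
    Prop :=
  ∃ (S : X → Lp ℝ a μ) (S' : X → X →L[ℝ] Lp ℝ a μ), HasLipDeriv S S' ∧ (∀ U, S U =ᵐ[μ] f U) ∧
    ∀ U W, S' U W =ᵐ[μ] f' U W

/-- The integrals of `t U V` define a differentiable map into the dual space of `Y` whose derivative
is Lipschitz continuous on balls and is given by the integrals of `t' U W V`. -/
def SmoothForm (μ : Measure α) (t : X → Y → α → ℝ) (t' : X → X → Y → α → ℝ) : Prop :=
  ∃ (T : X → Y →L[ℝ] ℝ) (T' : X → X →L[ℝ] Y →L[ℝ] ℝ), HasLipDeriv T T' ∧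
    (∀ U V, Integrable (t U V) μ ∧ T U V = ∫ x, t U V x ∂μ) ∧
    ∀ U W V, Integrable (t' U W V) μ ∧ T' U W V = ∫ x, t' U W V x ∂μ

namespace LinearInLp

variable {a b : ℝ≥0∞} [Fact (1 ≤ a)] [Fact (1 ≤ b)] {e e₁ e₂ : Y → α → ℝ}

theorem memLp (he : LinearInLp μ b e) (V : Y) : MemLp (e V) b μ := by
  obtain ⟨A, hA⟩ := he
  exact (memLp_congr_ae (hA V)).1 (Lp.memLp _)

theorem congr (he : LinearInLp μ b e₁) (h : ∀ V, e₁ V =ᵐ[μ] e₂ V) : LinearInLp μ b e₂ := by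
  obtain ⟨A, hA⟩ := he
  exact ⟨A, fun V => (hA V).trans (h V)⟩

theorem comp {Z : Type*} [NormedAddCommGroup Z] [NormedSpace ℝ Z] (he : LinearInLp μ b e)
    (B : Z →L[ℝ] Y) : LinearInLp μ b fun V => e (B V) := by
  obtain ⟨A, hA⟩ := he
  exact ⟨A.comp B, fun V => hA (B V)⟩

theorem add (h₁ : LinearInLp μ b e₁) (h₂ : LinearInLp μ b e₂) :
    LinearInLp μ b fun V x => e₁ V x + e₂ V x := by
  obtain ⟨A, hA⟩ := h₁
  obtain ⟨B, hB⟩ := h₂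
  exact ⟨A + B, fun V => (Lp.coeFn_add _ _).trans ((hA V).add (hB V))⟩

theorem zero : LinearInLp μ b fun (_ : Y) _ => (0 : ℝ) :=
  ⟨0, fun _ => Lp.coeFn_zero _ _ _⟩

theorem sum {ι : Type*} (s : Finset ι) {e : ι → Y → α → ℝ} (he : ∀ i ∈ s, LinearInLp μ b (e i)) :
    LinearInLp μ b fun V x => ∑ i ∈ s, e i V x := by
  classical
  induction s using Finset.induction_on with
  | empty => simpa using zero
  | insert i s hi ih =>
    simp only [Finset.sum_insert hi]
    exact (he i (by simp)).add (ih fun j hj => he j (by simp [hj]))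

/-- A linear family of functions with a norm bound is continuous into `L_b`. -/
theorem of_bound (C : ℝ) (hadd : ∀ V W, e (V + W) =ᵐ[μ] e V + e W)
    (hsmul : ∀ (c : ℝ) V, e (c • V) =ᵐ[μ] c • e V) (hmem : ∀ V, MemLp (e V) b μ)
    (hbound : ∀ V, (eLpNorm (e V) b μ).toReal ≤ C * ‖V‖) : LinearInLp μ b e := by
  let A : Y →ₗ[ℝ] Lp ℝ b μ :=
    { toFun := fun V => (hmem V).toLp _
      map_add' := fun V W => by
        rw [← MemLp.toLp_add]
        exact MemLp.toLp_congr _ _ (hadd V W)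
      map_smul' := fun c V => by
        rw [RingHom.id_apply, ← MemLp.toLp_const_smul]
        exact MemLp.toLp_congr _ _ (hsmul c V) }
  refine ⟨A.mkContinuous C fun V => ?_, fun V => MemLp.coeFn_toLp (hmem V)⟩
  exact (Lp.norm_toLp (e V) (hmem V)).trans_le (hbound V)

theorem id : LinearInLp μ b fun (V : Lp ℝ b μ) => (V : α → ℝ) :=
  ⟨.id ℝ _, fun _ => by rfl⟩

/-- On a finite measure space `L_b` embeds into `L_a` for `a ≤ b`. -/
theorem mono [IsFiniteMeasure μ] (he : LinearInLp μ b e) (hab : a ≤ b) : LinearInLp μ a e := by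
  obtain ⟨A, hA⟩ := he
  have h0 := rpow_measure_univ_ne_top (μ := μ) (Fact.out : 1 ≤ a) hab
  have key : LinearInLp μ a fun V : Lp ℝ b μ => (V : α → ℝ) := by
    refine of_bound ((μ univ) ^ (1 / a.toReal - 1 / b.toReal)).toReal
      (fun V W => Lp.coeFn_add V W) (fun c V => Lp.coeFn_smul c V)
      (fun V => (Lp.memLp V).mono_exponent hab) fun V => ?_
    rw [Lp.norm_def, mul_comm, ← ENNReal.toReal_mul]
    exact ENNReal.toReal_mono (ENNReal.mul_ne_top (Lp.eLpNorm_ne_top V) h0)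
      (eLpNorm_le_eLpNorm_mul_rpow_measure_univ hab (Lp.aestronglyMeasurable V))
  exact (key.comp A).congr hA

theorem smooth (he : LinearInLp μ b e) : SmoothInLp μ b e fun _ => e := by
  obtain ⟨A, hA⟩ := he
  exact ⟨A, fun _ => A, .clm A, hA, fun _ => hA⟩

end LinearInLp

namespace SmoothInLp

variable {a b c : ℝ≥0∞} [Fact (1 ≤ a)] [Fact (1 ≤ b)] [Fact (1 ≤ c)] {f g : X → α → ℝ}
  {f' g' : X → X → α → ℝ}

theorem memLp (hf : SmoothInLp μ a f f') (U : X) : MemLp (f U) a μ := by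
  obtain ⟨S, S', -, h, -⟩ := hf
  exact (memLp_congr_ae (h U)).1 (Lp.memLp _)

theorem memLp_deriv (hf : SmoothInLp μ a f f') (U W : X) : MemLp (f' U W) a μ := by
  obtain ⟨S, S', -, -, h⟩ := hf
  exact (memLp_congr_ae (h U W)).1 (Lp.memLp _)

theorem congr (hf : SmoothInLp μ a f f') (h : ∀ U, f U =ᵐ[μ] g U)
    (h' : ∀ U W, f' U W =ᵐ[μ] g' U W) : SmoothInLp μ a g g' := by
  obtain ⟨S, S', hS, h1, h2⟩ := hf
  exact ⟨S, S', hS, fun U => (h1 U).trans (h U), fun U W => (h2 U W).trans (h' U W)⟩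

theorem const {f : α → ℝ} (hf : MemLp f a μ) :
    SmoothInLp μ a (fun _ : X => f) fun _ _ _ => 0 :=
  ⟨fun _ => hf.toLp f, fun _ => 0, .const _, fun _ => hf.coeFn_toLp,
    fun _ _ => Lp.coeFn_zero _ _ _⟩

theorem add (hf : SmoothInLp μ a f f') (hg : SmoothInLp μ a g g') :
    SmoothInLp μ a (fun U x => f U x + g U x) fun U W x => f' U W x + g' U W x := by
  obtain ⟨S, S', hS, h1, h2⟩ := hf
  obtain ⟨T, T', hT, k1, k2⟩ := hg
  exact ⟨_, _, hS.add hT, fun U => (Lp.coeFn_add _ _).trans ((h1 U).add (k1 U)),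
    fun U W => (Lp.coeFn_add _ _).trans ((h2 U W).add (k2 U W))⟩

theorem sum {ι : Type*} (s : Finset ι) {f : ι → X → α → ℝ} {f' : ι → X → X → α → ℝ}
    (hf : ∀ i ∈ s, SmoothInLp μ a (f i) (f' i)) :
    SmoothInLp μ a (fun U x => ∑ i ∈ s, f i U x) fun U W x => ∑ i ∈ s, f' i U W x := by
  classical
  induction s using Finset.induction_on with
  | empty =>
    simp only [Finset.sum_empty]
    exact const (f := fun _ => 0) MemLp.zero
  | insert i s hi ih =>
    simp only [Finset.sum_insert hi]
    exact (hf i (by simp)).add (ih fun j hj => hf j (by simp [hj]))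

theorem mul [ENNReal.HolderTriple a b c] (hf : SmoothInLp μ a f f') (hg : SmoothInLp μ b g g') :
    SmoothInLp μ c (fun U x => f U x * g U x)
      fun U W x => f' U W x * g U x + f U x * g' U W x := by
  obtain ⟨S, S', hS, h1, h2⟩ := hf
  obtain ⟨T, T', hT, k1, k2⟩ := hg
  refine ⟨_, _, hS.bilin (mulL μ a b c) hT, fun U => ?_, fun U W => ?_⟩
  · exact (coeFn_mulL _ _).trans ((h1 U).mul (k1 U))
  · rw [add_comm]
    exact (Lp.coeFn_add _ _).trans (((coeFn_mulL _ _).trans ((h2 U W).mul (k1 U))).add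
      ((coeFn_mulL _ _).trans ((h1 U).mul (k2 U W))))

theorem neg (hf : SmoothInLp μ a f f') :
    SmoothInLp μ a (fun U x => -f U x) fun U W x => -f' U W x := by
  obtain ⟨S, S', hS, h1, h2⟩ := hf
  refine ⟨_, _, hS.clm_comp (-.id ℝ _), fun U => ?_, fun U W => ?_⟩
  · exact (Lp.coeFn_neg _).trans (h1 U).neg
  · exact (Lp.coeFn_neg _).trans (h2 U W).neg

theorem mono [IsFiniteMeasure μ] (hf : SmoothInLp μ b f f') (hab : a ≤ b) :
    SmoothInLp μ a f f' := by
  obtain ⟨S, S', hS, h1, h2⟩ := hf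
  obtain ⟨A, hA⟩ := (LinearInLp.id (μ := μ) (b := b)).mono hab
  exact ⟨_, _, hS.clm_comp A, fun U => (hA _).trans (h1 U), fun U W => (hA _).trans (h2 U W)⟩

/-- The chain rule for a `C²` function of a map into `L_∞`. -/
theorem superpose {k : ℝ → ℝ} (hk : ContDiff ℝ 2 k) (hf : SmoothInLp μ ∞ f f') :
    SmoothInLp μ ∞ (fun U x => k (f U x)) fun U W x => deriv k (f U x) * f' U W x := by
  obtain ⟨S, S', hS, h1, h2⟩ := hf
  refine ⟨_, _, (hasLipDeriv_nemytskii hk).comp hS, fun U => ?_, fun U W => ?_⟩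
  · exact (coeFn_nemytskii _ _ _).trans ((h1 U).fun_comp k)
  · exact (coeFn_mulL _ _).trans (((coeFn_nemytskii _ _ _).trans ((h1 U).fun_comp _)).mul (h2 U W))

/-- The pairing with a linear family in the dual Lebesgue space. -/
theorem pair [ENNReal.HolderConjugate a b] (hf : SmoothInLp μ a f f') {e : Y → α → ℝ}
    (he : LinearInLp μ b e) :
    SmoothForm μ (fun U V x => f U x * e V x) fun U W V x => f' U W x * e V x := by
  have hint : ∀ {f g : α → ℝ}, MemLp f a μ → MemLp g b μ → Integrable (fun x => f x * g x) μ :=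
    fun hf hg => memLp_one_iff_integrable.1 (hg.mul hf)
  have h1 := hf.memLp
  have h2 := hf.memLp_deriv
  have h3 := he.memLp
  obtain ⟨S, S', hS, k1, k2⟩ := hf
  obtain ⟨A, hA⟩ := he
  let P : Lp ℝ a μ →L[ℝ] Y →L[ℝ] ℝ :=
    ((ContinuousLinearMap.compL ℝ Y (Lp ℝ b μ) ℝ).flip A).comp
      ((ContinuousLinearMap.mul ℝ ℝ).lpPairing μ a b)
  have hP : ∀ g V, P g V = ∫ x, g x * A V x ∂μ := fun g V =>
    (ContinuousLinearMap.mul ℝ ℝ).lpPairing_eq_integral g (A V)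
  refine ⟨_, _, hS.clm_comp P, fun U V => ⟨hint (h1 U) (h3 V), ?_⟩,
    fun U W V => ⟨hint (h2 U W) (h3 V), ?_⟩⟩
  · rw [hP]
    exact integral_congr_ae ((k1 U).mul (hA V))
  · refine (hP _ V).trans ?_
    exact integral_congr_ae ((k2 U W).mul (hA V))

end SmoothInLp

namespace SmoothForm

variable {t s : X → Y → α → ℝ} {t' s' : X → X → Y → α → ℝ}

theorem congr (ht : SmoothForm μ t t') (h : ∀ U V, t U V =ᵐ[μ] s U V)
    (h' : ∀ U W V, t' U W V =ᵐ[μ] s' U W V) : SmoothForm μ s s' := by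
  obtain ⟨T, T', hT, h1, h2⟩ := ht
  refine ⟨T, T', hT, fun U V => ?_, fun U W V => ?_⟩
  · rw [← integral_congr_ae (h U V), ← integrable_congr (h U V)]
    exact h1 U V
  · rw [← integral_congr_ae (h' U W V), ← integrable_congr (h' U W V)]
    exact h2 U W V

theorem zero : SmoothForm μ (fun (_ : X) (_ : Y) _ => 0) fun _ _ _ _ => 0 :=
  ⟨_, _, .const 0, by simp, by simp⟩

theorem add (ht : SmoothForm μ t t') (hs : SmoothForm μ s s') :
    SmoothForm μ (fun U V x => t U V x + s U V x) fun U W V x => t' U W V x + s' U W V x := by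
  obtain ⟨T, T', hT, h1, h2⟩ := ht
  obtain ⟨S, S', hS, k1, k2⟩ := hs
  refine ⟨_, _, hT.add hS, fun U V => ⟨(h1 U V).1.add (k1 U V).1, ?_⟩,
    fun U W V => ⟨(h2 U W V).1.add (k2 U W V).1, ?_⟩⟩
  · rw [integral_add (h1 U V).1 (k1 U V).1, ← (h1 U V).2, ← (k1 U V).2]
    rfl
  · rw [integral_add (h2 U W V).1 (k2 U W V).1, ← (h2 U W V).2, ← (k2 U W V).2]
    rfl

theorem sum {ι : Type*} (s : Finset ι) {t : ι → X → Y → α → ℝ} {t' : ι → X → X → Y → α → ℝ}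
    (ht : ∀ i ∈ s, SmoothForm μ (t i) (t' i)) :
    SmoothForm μ (fun U V x => ∑ i ∈ s, t i U V x) fun U W V x => ∑ i ∈ s, t' i U W V x := by
  classical
  induction s using Finset.induction_on with
  | empty => simpa using zero
  | insert i s hi ih =>
    simp only [Finset.sum_insert hi]
    exact (ht i (by simp)).add (ih fun j hj => ht j (by simp [hj]))

theorem integrable (ht : SmoothForm μ t t') (U : X) (V : Y) : Integrable (t U V) μ := by
  obtain ⟨T, T', -, h, -⟩ := ht
  exact (h U V).1

theorem integrable_deriv (ht : SmoothForm μ t t') (U W : X) (V : Y) :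
    Integrable (t' U W V) μ := by
  obtain ⟨T, T', -, -, h⟩ := ht
  exact (h U W V).1

end SmoothForm

end Representatives

/-! ### Morrey's inequality -/

section Morrey

variable {d : ℕ}

/-- The fundamental theorem of calculus along the segment from `x` to `x + z`. -/
theorem enorm_le_add_lintegral_segment {ζ : E d → ℝ} (hζ : ContDiff ℝ 1 ζ) (x : E d) {z : E d}
    (hz : ‖z‖ ≤ 1) :
    ‖ζ x‖ₑ ≤ ‖ζ (x + z)‖ₑ + ∫⁻ t in Ioc (0 : ℝ) 1, ‖fderiv ℝ ζ (x + t • z)‖ₑ := by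
  have hd : ∀ t : ℝ, HasDerivAt (fun t : ℝ => ζ (x + t • z)) (fderiv ℝ ζ (x + t • z) z) t := by
    intro t
    have h1 : HasDerivAt (fun t : ℝ => x + t • z) z t := by
      simpa using ((hasDerivAt_id t).smul_const z).const_add x
    exact ((hζ.differentiable one_ne_zero _).hasFDerivAt).comp_hasDerivAt t h1
  have hc : Continuous fun t : ℝ => fderiv ℝ ζ (x + t • z) z :=
    ((hζ.continuous_fderiv one_ne_zero).comp (by fun_prop)).clm_apply continuous_const
  have h1 := intervalIntegral.integral_eq_sub_of_hasDerivAt (a := 0) (b := 1) (fun t _ => hd t)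
    (hc.intervalIntegrable 0 1)
  simp only [one_smul, zero_smul, add_zero] at h1
  rw [intervalIntegral.integral_of_le zero_le_one] at h1
  have h2 : ζ x = ζ (x + z) - ∫ t in Ioc (0 : ℝ) 1, fderiv ℝ ζ (x + t • z) z := by linarith
  calc ‖ζ x‖ₑ ≤ ‖ζ (x + z)‖ₑ + ‖∫ t in Ioc (0 : ℝ) 1, fderiv ℝ ζ (x + t • z) z‖ₑ := by
        rw [h2]; exact enorm_sub_le
    _ ≤ ‖ζ (x + z)‖ₑ + ∫⁻ t in Ioc (0 : ℝ) 1, ‖fderiv ℝ ζ (x + t • z) z‖ₑ := by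
        gcongr; exact enorm_integral_le_lintegral_enorm _
    _ ≤ _ := by
        gcongr with t
        refine (ContinuousLinearMap.le_opENorm _ _).trans ?_
        refine mul_le_of_le_one_right' ?_
        rw [← ofReal_norm]
        exact ENNReal.ofReal_le_one.2 hz

/-- Hölder's inequality on a ball of radius `t`, rescaled to the unit ball. -/
theorem lintegral_ball_scaled_le {F : Type*} [NormedAddCommGroup F] {g : E d → F}
    (hg : Continuous g) {p : ℝ≥0∞} (hp : 1 ≤ p) (hp_top : p ≠ ⊤) (x : E d) {t : ℝ} (ht : t ≠ 0) :
    ∫⁻ z in Metric.ball (0 : E d) 1, ‖g (x + t • z)‖ₑ ≤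
      ENNReal.ofReal |(t ^ d)⁻¹| ^ (1 / p).toReal * (eLpNorm g p volume *
        volume (Metric.ball (0 : E d) 1) ^ (1 - 1 / p.toReal)) := by
  have hp0 : p ≠ 0 := (zero_lt_one.trans_le hp).ne'
  have h1 := eLpNorm_le_eLpNorm_mul_rpow_measure_univ (f := fun z => g (x + t • z))
    (μ := volume.restrict (Metric.ball (0 : E d) 1)) hp
    (hg.comp (by fun_prop)).aestronglyMeasurable
  rw [eLpNorm_one_eq_lintegral_enorm] at h1
  simp only [Measure.restrict_apply_univ, ENNReal.toReal_one, div_one] at h1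
  refine h1.trans ?_
  rw [← mul_assoc]
  gcongr
  refine (eLpNorm_mono_measure _ Measure.restrict_le_self).trans_eq ?_
  have h2 : eLpNorm (fun z => g (x + t • z)) p volume
      = eLpNorm (fun z => g (x + z)) p (Measure.map (t • ·) (volume : Measure (E d))) :=
    (eLpNorm_map_measure (g := fun z => g (x + z)) (hg.comp (by fun_prop)).aestronglyMeasurable
      (by fun_prop)).symm
  rw [h2, Measure.map_addHaar_smul _ ht, eLpNorm_smul_measure_of_ne_top hp_top]
  congr 1
  · simp
  · exact eLpNorm_comp_measurePreserving (g := g) hg.aestronglyMeasurable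
      (measurePreserving_add_left volume x)

/-- Morrey's inequality: for `p > d` the supremum of a `C¹` function is bounded by its norm in
`W^1_p(ℝ^d)`. The value at `x` is compared with the values on the unit ball around `x` along
segments; the resulting integral `∫₀¹ t^{-d/p} dt` is finite. -/
theorem exists_morrey_bound {p : ℝ≥0∞} (hp : 1 ≤ p) (hdp : (d : ℝ≥0∞) < p) (hp_top : p ≠ ⊤) :
    ∃ C : ℝ≥0∞, C ≠ ⊤ ∧ ∀ ζ : E d → ℝ, ContDiff ℝ 1 ζ → ∀ x,
      ‖ζ x‖ₑ ≤ C * (eLpNorm ζ p volume + eLpNorm (fderiv ℝ ζ) p volume) := by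
  have hp0 : p ≠ 0 := (zero_lt_one.trans_le hp).ne'
  set B := Metric.ball (0 : E d) 1
  set b := volume B with hb
  have hb0 : b ≠ 0 := (Metric.measure_ball_pos volume _ one_pos).ne'
  have hbt : b ≠ ⊤ := measure_ball_lt_top.ne
  set β := b ^ (1 - 1 / p.toReal) with hβ
  have hβt : β ≠ ⊤ := ENNReal.rpow_ne_top_of_ne_zero hb0 hbt
  set κ := ∫⁻ t in Ioc (0 : ℝ) 1, ENNReal.ofReal |(t ^ d)⁻¹| ^ (1 / p).toReal with hκ
  -- the integrand is `t ^ (-d / p)`, integrable near `0` because `d < p`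
  have hκt : κ ≠ ⊤ := by
    have hlt : (d : ℝ) / p.toReal < 1 := by
      rw [div_lt_one (ENNReal.toReal_pos hp0 hp_top)]
      have := (ENNReal.toReal_lt_toReal (by simp) hp_top).2 hdp
      simpa using this
    have hi := (intervalIntegral.intervalIntegrable_rpow' (a := 0) (b := 1)
      (r := -((d : ℝ) / p.toReal)) (by linarith)).1
    have h3 : κ = ∫⁻ t in Ioc (0 : ℝ) 1, ‖t ^ (-((d : ℝ) / p.toReal))‖ₑ := by
      refine setLIntegral_congr_fun measurableSet_Ioc fun t ht => ?_
      have ht0 : 0 < t := ht.1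
      rw [abs_of_nonneg (by positivity), ENNReal.ofReal_rpow_of_nonneg (by positivity)
        ENNReal.toReal_nonneg, Real.enorm_of_nonneg (by positivity)]
      congr 1
      rw [← Real.rpow_natCast, ← Real.rpow_neg ht0.le, ← Real.rpow_mul ht0.le]
      congr 1
      simp [div_eq_mul_inv]
    rw [h3]
    exact hi.2.ne
  refine ⟨b⁻¹ * (β * (1 + κ)), ENNReal.mul_ne_top (ENNReal.inv_ne_top.2 hb0)
    (ENNReal.mul_ne_top hβt (by simp [hκt])), fun ζ hζ x => ?_⟩
  have hcf : Continuous (fderiv ℝ ζ) := hζ.continuous_fderiv one_ne_zero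
  have hcx : Continuous fun z => ζ (x + z) := hζ.continuous.comp (continuous_const_add x)
  -- averaging over the unit ball around `x`, then exchanging the order of integration
  have hmain : b * ‖ζ x‖ₑ ≤ β * (1 + κ) * (eLpNorm ζ p volume + eLpNorm (fderiv ℝ ζ) p volume) := by
    calc b * ‖ζ x‖ₑ = ∫⁻ _ in B, ‖ζ x‖ₑ := by rw [setLIntegral_const, mul_comm]
      _ ≤ ∫⁻ z in B, (‖ζ (x + z)‖ₑ + ∫⁻ t in Ioc (0 : ℝ) 1, ‖fderiv ℝ ζ (x + t • z)‖ₑ) := by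
          refine setLIntegral_mono' measurableSet_ball fun z hz => ?_
          exact enorm_le_add_lintegral_segment hζ x (by simpa [B] using (mem_ball_zero_iff.1 hz).le)
      _ = (∫⁻ z in B, ‖ζ (x + (1 : ℝ) • z)‖ₑ)
          + ∫⁻ t in Ioc (0 : ℝ) 1, ∫⁻ z in B, ‖fderiv ℝ ζ (x + t • z)‖ₑ := by
          rw [lintegral_add_left hcx.enorm.measurable]
          congr 1
          · simp
          · refine lintegral_lintegral_swap (Measurable.aemeasurable ?_)
            exact (hcf.comp
              (by fun_prop : Continuous fun q : E d × ℝ => x + q.2 • q.1)).enorm.measurable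
      _ ≤ eLpNorm ζ p volume * β + ∫⁻ t in Ioc (0 : ℝ) 1,
            ENNReal.ofReal |(t ^ d)⁻¹| ^ (1 / p).toReal
            * (eLpNorm (fderiv ℝ ζ) p volume * β) := by
          gcongr ?_ + ?_
          · refine (lintegral_ball_scaled_le hζ.continuous hp hp_top x one_ne_zero).trans_eq ?_
            simp [hβ, hb, B]
          · exact setLIntegral_mono' measurableSet_Ioc fun t ht =>
              lintegral_ball_scaled_le hcf hp hp_top x ht.1.ne'
      _ = eLpNorm ζ p volume * β + κ * (eLpNorm (fderiv ℝ ζ) p volume * β) := by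
          rw [lintegral_mul_const _ (by fun_prop)]
      _ ≤ _ := by
          have : β * (1 + κ) * (eLpNorm ζ p volume + eLpNorm (fderiv ℝ ζ) p volume)
            = (eLpNorm ζ p volume * β + κ * (eLpNorm (fderiv ℝ ζ) p volume * β))
              + (eLpNorm (fderiv ℝ ζ) p volume * β + κ * (eLpNorm ζ p volume * β)) := by ring
          rw [this]
          exact le_self_add
  calc ‖ζ x‖ₑ = b⁻¹ * (b * ‖ζ x‖ₑ) := by
        rw [← mul_assoc, ENNReal.inv_mul_cancel hb0 hbt, one_mul]
    _ ≤ _ := by rw [mul_assoc]; gcongr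

end Morrey

/-! ### Weak gradients -/

section WeakGradient

variable {d : ℕ} {Ω : Set (E d)}

theorem partialDeriv_eq_gradient (i : Fin d) (ζ : E d → ℝ) (x : E d) :
    partialDeriv i ζ x = gradient ζ x i := by
  rw [partialDeriv, ← toDual_gradient, InnerProductSpace.toDual_apply_apply,
    EuclideanSpace.inner_single_right, one_mul, conj_trivial]

theorem IsTest.continuous_gradient {ζ : E d → ℝ} (hζ : IsTest Ω ζ) :
    Continuous (gradient ζ) :=
  (InnerProductSpace.toDual ℝ (E d)).symm.continuous.comp
    (hζ.contDiff.continuous_fderiv (by simp))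

theorem norm_gradient (ζ : E d → ℝ) (x : E d) : ‖gradient ζ x‖ = ‖fderiv ℝ ζ x‖ := by
  rw [gradient, LinearIsometryEquiv.norm_map]

/-- Integration over `Ω` against a function vanishing outside `Ω` is integration over the whole
space. -/
theorem IsTest.setIntegral_mul {ζ : E d → ℝ} (hζ : IsTest Ω ζ) (u : E d → ℝ) :
    ∫ x in Ω, u x * ζ x = ∫ x, u x * ζ x := by
  refine setIntegral_eq_integral_of_forall_compl_eq_zero fun x hx => ?_
  rw [image_eq_zero_of_notMem_tsupport fun h => hx (hζ.tsupport_subset h), mul_zero]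

theorem IsTest.integral_mul_partialDeriv {ζ u : E d → ℝ} (hζ : IsTest Ω ζ) (hu : ContDiff ℝ 1 u)
    (i : Fin d) : ∫ x, u x * Nanofluid.partialDeriv i ζ x
      = - ∫ x, Nanofluid.partialDeriv i u x * ζ x := by
  have hc : Continuous fun x => fderiv ℝ u x (EuclideanSpace.single i 1) :=
    (hu.continuous_fderiv one_ne_zero).clm_apply continuous_const
  refine integral_mul_fderiv_eq_neg_fderiv_mul_of_integrable ?_ ?_ ?_
    (fun x _ => hu.differentiable one_ne_zero x)
    (fun x _ => hζ.contDiff.differentiable (by simp) x)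
  · exact (hc.mul hζ.contDiff.continuous).integrable_of_hasCompactSupport
      hζ.hasCompactSupport.mul_left
  · exact (hu.continuous.mul
      (hζ.partialDeriv i).contDiff.continuous).integrable_of_hasCompactSupport
      (hζ.partialDeriv i).hasCompactSupport.mul_left
  · exact (hu.continuous.mul hζ.contDiff.continuous).integrable_of_hasCompactSupport
      hζ.hasCompactSupport.mul_left

theorem IsTest.hasWeakGrad {u : E d → ℝ} (hu : IsTest Ω u) : HasWeakGrad Ω u (gradient u) where
  locallyIntegrableOn := (hu.contDiff.continuous.locallyIntegrable).locallyIntegrableOn _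
  locallyIntegrableOn_grad := hu.continuous_gradient.locallyIntegrable.locallyIntegrableOn _
  integral_eq ζ hζ i := by
    rw [(hζ.partialDeriv i).setIntegral_mul, hζ.setIntegral_mul,
      hζ.integral_mul_partialDeriv (hu.contDiff.of_le (by simp))]
    simp only [partialDeriv_eq_gradient]

theorem _root_.MeasureTheory.LocallyIntegrableOn.coord {G : E d → E d} {s : Set (E d)}
    (hG : LocallyIntegrableOn G s) (i : Fin d) : LocallyIntegrableOn (fun x => G x i) s := by
  intro x hx
  obtain ⟨t, ht, hi⟩ := hG x hx
  exact ⟨t, ht, (EuclideanSpace.proj (𝕜 := ℝ) i).integrable_comp hi⟩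

/-- Weak gradients are unique up to null sets. -/
theorem HasWeakGrad.ae_eq (hΩ : IsOpen Ω) {u v : E d → ℝ} {G H : E d → E d}
    (hu : HasWeakGrad Ω u G) (hv : HasWeakGrad Ω v H) (huv : u =ᵐ[volume.restrict Ω] v) :
    G =ᵐ[volume.restrict Ω] H := by
  have key : ∀ i, ∀ᵐ x ∂volume.restrict Ω, G x i - H x i = 0 := by
    intro i
    rw [ae_restrict_iff' hΩ.measurableSet]
    have hG := hu.locallyIntegrableOn_grad.coord i
    have hH := hv.locallyIntegrableOn_grad.coord i
    refine hΩ.ae_eq_zero_of_integral_contDiff_smul_eq_zero (hG.sub hH) fun ζ h1 h2 h3 => ?_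
    have hζ : IsTest Ω ζ := ⟨h1, h2, h3⟩
    have hGi : ∀ {g : E d → ℝ}, LocallyIntegrableOn g Ω → IntegrableOn (fun x => g x * ζ x) Ω := by
      intro g hg
      have hK : IntegrableOn (fun x => g x * ζ x) (tsupport ζ) :=
        (hg.integrableOn_compact_subset h3 h2).mul_continuousOn_of_subset
          h1.continuous.continuousOn h2.measurableSet h2 Subset.rfl
      refine (integrableOn_iff_integrable_of_support_subset ?_).1 hK |>.integrableOn
      exact fun x hx => subset_tsupport ζ (right_ne_zero_of_mul hx)
    have e1 := hu.integral_eq ζ hζ i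
    have e2 := hv.integral_eq ζ hζ i
    have e3 : ∫ x in Ω, u x * Nanofluid.partialDeriv i ζ x
        = ∫ x in Ω, v x * Nanofluid.partialDeriv i ζ x :=
      integral_congr_ae (huv.mono fun x hx => by simp only [hx])
    calc ∫ x, ζ x • (G x i - H x i) = ∫ x, (G x i - H x i) * ζ x := by
          simp only [smul_eq_mul, mul_comm]
      _ = ∫ x in Ω, (G x i - H x i) * ζ x := (hζ.setIntegral_mul _).symm
      _ = (∫ x in Ω, G x i * ζ x) - ∫ x in Ω, H x i * ζ x := by
          rw [← integral_sub (hGi hG) (hGi hH)]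
          simp only [sub_mul]
      _ = 0 := by linarith
  filter_upwards [ae_all_iff.2 key] with x hx
  ext i
  exact sub_eq_zero.1 (hx i)

theorem weakGrad_ae_eq (hΩ : IsOpen Ω) {u : E d → ℝ} {G : E d → E d} (hu : HasWeakGrad Ω u G) :
    weakGrad Ω u =ᵐ[volume.restrict Ω] G := by
  have h : ∃ G, HasWeakGrad Ω u G := ⟨G, hu⟩
  rw [weakGrad, dif_pos h]
  exact h.choose_spec.ae_eq hΩ hu (by rfl)

end WeakGradient

/-! ### Embeddings of Sobolev spaces -/

section Embedding

variable {d : ℕ} {Ω : Set (E d)} {p : ℝ≥0∞} [Fact (1 ≤ p)]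

theorem Sobolev.hasWeakGrad (u : Sobolev Ω p) : HasWeakGrad Ω u.fn u.grad := u.2

theorem Sobolev.eLpNorm_fn_le (u : Sobolev Ω p) :
    eLpNorm u.fn p (volume.restrict Ω) ≤ ENNReal.ofReal ‖u‖ := by
  rw [Sobolev.fn, ← Lp.enorm_def, ← ofReal_norm]
  exact ENNReal.ofReal_le_ofReal (WithLp.norm_fst_le _ u.1)

theorem Sobolev.eLpNorm_grad_le (u : Sobolev Ω p) :
    eLpNorm u.grad p (volume.restrict Ω) ≤ ENNReal.ofReal ‖u‖ := by
  rw [Sobolev.grad, ← Lp.enorm_def, ← ofReal_norm]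
  exact ENNReal.ofReal_le_ofReal (WithLp.norm_snd_le _ u.1)

theorem Sobolev.memLp_fn (u : Sobolev Ω p) : MemLp u.fn p (volume.restrict Ω) := Lp.memLp _

theorem Sobolev.memLp_grad (u : Sobolev Ω p) : MemLp u.grad p (volume.restrict Ω) := Lp.memLp _

theorem Sobolev.fn_add (u v : Sobolev Ω p) :
    (u + v).fn =ᵐ[volume.restrict Ω] u.fn + v.fn := Lp.coeFn_add u.1.fst v.1.fst

theorem Sobolev.grad_add (u v : Sobolev Ω p) :
    (u + v).grad =ᵐ[volume.restrict Ω] u.grad + v.grad := Lp.coeFn_add u.1.snd v.1.snd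

theorem Sobolev.fn_smul (c : ℝ) (u : Sobolev Ω p) :
    (c • u).fn =ᵐ[volume.restrict Ω] c • u.fn := Lp.coeFn_smul c u.1.fst

theorem Sobolev.grad_smul (c : ℝ) (u : Sobolev Ω p) :
    (c • u).grad =ᵐ[volume.restrict Ω] c • u.grad := Lp.coeFn_smul c u.1.snd

/-- An inequality `‖ζ‖_q ≤ C (‖ζ‖_p + ‖∇ζ‖_p)` for test functions yields an embedding of
their closure into `L_q`, by Fatou's lemma along a subsequence converging almost everywhere. -/
theorem linearInLp_fn_of_test (hΩ : IsOpen Ω) {q : ℝ≥0∞} [Fact (1 ≤ q)] {C : ℝ≥0∞} (hC : C ≠ ⊤)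
    (h : ∀ ζ : E d → ℝ, IsTest Ω ζ → eLpNorm ζ q (volume.restrict Ω) ≤
      C * (eLpNorm ζ p (volume.restrict Ω) + eLpNorm (fderiv ℝ ζ) p (volume.restrict Ω))) :
    LinearInLp (volume.restrict Ω) q fun u : Sobolev0 Ω p => u.fn := by
  have h1 : ∀ w : Sobolev Ω p, w ∈ testFunctions Ω p →
      eLpNorm w.fn q (volume.restrict Ω) ≤ C * 2 * ENNReal.ofReal ‖w‖ := by
    rintro w ⟨ζ, hζ, hw⟩
    have hg := w.hasWeakGrad.ae_eq hΩ hζ.hasWeakGrad hw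
    have e1 : eLpNorm (fderiv ℝ ζ) p (volume.restrict Ω)
        = eLpNorm (gradient ζ) p (volume.restrict Ω) :=
      eLpNorm_congr_norm_ae (.of_forall fun x => (norm_gradient ζ x).symm)
    refine (eLpNorm_congr_ae hw).trans_le ((h ζ hζ).trans ?_)
    rw [e1, ← eLpNorm_congr_ae hw, ← eLpNorm_congr_ae hg, mul_assoc, two_mul]
    gcongr
    exacts [w.eLpNorm_fn_le, w.eLpNorm_grad_le]
  have h2 : ∀ u : Sobolev0 Ω p,
      eLpNorm u.fn q (volume.restrict Ω) ≤ C * 2 * ENNReal.ofReal ‖u‖ := by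
    intro u
    obtain ⟨w, hw, hlim⟩ := mem_closure_iff_seq_limit.1
      (show u.toSobolev ∈ closure (testFunctions Ω p : Set (Sobolev Ω p)) from u.2)
    have hfst : Filter.Tendsto (fun n => (w n).1.fst) Filter.atTop (𝓝 u.toSobolev.1.fst) :=
      ((WithLp.fstL p ℝ (LpR Ω p) (LpE Ω p)).continuous.tendsto _).comp
        ((continuous_subtype_val.tendsto _).comp hlim)
    obtain ⟨ns, hns, hae⟩ := (tendstoInMeasure_of_tendsto_Lp hfst).exists_seq_tendsto_ae
    have h3 : eLpNorm u.fn q (volume.restrict Ω)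
        ≤ Filter.liminf (fun n => eLpNorm (w (ns n)).fn q (volume.restrict Ω)) Filter.atTop :=
      Lp.eLpNorm_lim_le_liminf_eLpNorm (fun n => Lp.aestronglyMeasurable _) _ hae
    have h4 : Filter.Tendsto (fun n => C * 2 * ENNReal.ofReal ‖w (ns n)‖) Filter.atTop
        (𝓝 (C * 2 * ENNReal.ofReal ‖u.toSobolev‖)) := by
      refine ENNReal.Tendsto.const_mul ?_ (.inr (ENNReal.mul_ne_top hC (by simp)))
      exact (ENNReal.continuous_ofReal.tendsto _).comp
        ((hlim.comp hns.tendsto_atTop).norm)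
    refine h3.trans ?_
    rw [show ‖u‖ = ‖u.toSobolev‖ from rfl, ← h4.liminf_eq]
    exact Filter.liminf_le_liminf (.of_forall fun n => h1 _ (hw _))
  have hC2 : C * 2 ≠ ⊤ := ENNReal.mul_ne_top hC (by simp)
  refine LinearInLp.of_bound (C * 2).toReal (fun u v => Sobolev.fn_add _ _)
    (fun c u => Sobolev.fn_smul _ _) (fun u => ⟨(Lp.memLp _).1, ?_⟩) fun u => ?_
  · exact (h2 u).trans_lt (ENNReal.mul_lt_top hC2.lt_top ENNReal.ofReal_lt_top)
  · have := ENNReal.toReal_mono (ENNReal.mul_ne_top hC2 ENNReal.ofReal_ne_top) (h2 u)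
    rwa [ENNReal.toReal_mul, ENNReal.toReal_ofReal (norm_nonneg _)] at this

theorem linearInLp_fn : LinearInLp (volume.restrict Ω) p fun u : Sobolev0 Ω p => u.fn := by
  refine LinearInLp.of_bound 1 (fun u v => Sobolev.fn_add _ _) (fun c u => Sobolev.fn_smul _ _)
    (fun u => Lp.memLp _) fun u => ?_
  rw [one_mul]
  exact WithLp.norm_fst_le _ u.toSobolev.1

theorem linearInLp_grad (i : Fin d) :
    LinearInLp (volume.restrict Ω) p fun (u : Sobolev0 Ω p) x => u.grad x i := by
  refine LinearInLp.of_bound 1 (fun u v => ?_) (fun c u => ?_)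
    (fun u => (Lp.memLp u.toSobolev.1.snd).eval_piLp i) fun u => ?_
  · exact (Sobolev.grad_add u.toSobolev v.toSobolev).fun_comp fun z : E d => z i
  · exact (Sobolev.grad_smul c u.toSobolev).fun_comp fun z : E d => z i
  · rw [one_mul]
    refine le_trans ?_ (WithLp.norm_snd_le _ u.toSobolev.1)
    refine ENNReal.toReal_mono (Lp.eLpNorm_ne_top _) (eLpNorm_mono fun x => ?_)
    exact PiLp.norm_apply_le _ i

theorem IsTest.support_subset {ζ : E d → ℝ} (hζ : IsTest Ω ζ) : Function.support ζ ⊆ Ω :=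
  (subset_tsupport ζ).trans hζ.tsupport_subset

theorem IsTest.support_fderiv_subset {ζ : E d → ℝ} (hζ : IsTest Ω ζ) :
    Function.support (fderiv ℝ ζ) ⊆ Ω :=
  (_root_.support_fderiv_subset ℝ).trans hζ.tsupport_subset

/-- The embedding of `W^1_p` with zero boundary values into `L_∞` for `p > d`. -/
theorem linearInLp_top (hΩ : IsOpen Ω) (hdp : (d : ℝ≥0∞) < p) (hp_top : p ≠ ⊤) :
    LinearInLp (volume.restrict Ω) ⊤ fun u : Sobolev0 Ω p => u.fn := by
  obtain ⟨C, hC, h⟩ := exists_morrey_bound (Fact.out : 1 ≤ p) hdp hp_top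
  refine linearInLp_fn_of_test hΩ hC fun ζ hζ => ?_
  rw [eLpNorm_restrict_eq_of_support_subset hζ.support_subset,
    eLpNorm_restrict_eq_of_support_subset hζ.support_subset,
    eLpNorm_restrict_eq_of_support_subset (f := fderiv ℝ ζ) (p := p)
      hζ.support_fderiv_subset, eLpNorm_exponent_top]
  exact essSup_le_of_ae_le _ (.of_forall fun x => h ζ (hζ.contDiff.of_le (by simp)) x)

/-- The Sobolev embedding of `W^1_p` with zero boundary values on a bounded set. The exponent
`r ≤ p` in the Gagliardo-Nirenberg-Sobolev inequality allows for the case `p = d`. -/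
theorem linearInLp_sobolev (hΩ : IsOpen Ω) (hb : Bornology.IsBounded Ω) {r : NNReal}
    {q : ℝ≥0∞} [Fact (1 ≤ q)] (hq_top : q ≠ ⊤) (hr : 1 ≤ r) (hrp : (r : ℝ≥0∞) ≤ p) (hrd : r < d)
    (hq : (r : ℝ)⁻¹ - (d : ℝ)⁻¹ ≤ q.toReal⁻¹) :
    LinearInLp (volume.restrict Ω) q fun u : Sobolev0 Ω p => u.fn := by
  have : IsFiniteMeasure (volume.restrict Ω) := ⟨by simpa using hb.measure_lt_top⟩
  lift q to NNReal using hq_top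
  have hK := rpow_measure_univ_ne_top (μ := volume.restrict Ω) (mod_cast hr) hrp
  refine linearInLp_fn_of_test (C := eLpNormLESNormFDerivOfLeConst ℝ volume Ω r q *
    volume.restrict Ω univ ^ (1 / (r : ℝ≥0∞).toReal - 1 / p.toReal)) hΩ
    (ENNReal.mul_ne_top ENNReal.coe_ne_top hK) fun ζ hζ => ?_
  have h1 := eLpNorm_le_eLpNorm_fderiv_of_le volume (hζ.contDiff.of_le (by simp))
    hζ.support_subset hr (by simpa using hrd) (by simpa using hq) hb
  rw [← eLpNorm_restrict_eq_of_support_subset hζ.support_subset,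
    ← eLpNorm_restrict_eq_of_support_subset (f := fderiv ℝ ζ) hζ.support_fderiv_subset] at h1
  refine h1.trans ?_
  have h2 := eLpNorm_le_eLpNorm_mul_rpow_measure_univ hrp
    (hζ.contDiff.continuous_fderiv (by simp)).aestronglyMeasurable
      (μ := volume.restrict Ω)
  rw [mul_assoc, mul_comm (volume.restrict Ω univ ^ _)]
  gcongr
  refine h2.trans ?_
  gcongr
  exact le_add_self

end Embedding

/-! ### Mollification and the chain rule -/

section Mollification

/-- The dominated convergence theorem with a convergent sequence of majorants. -/
theorem tendsto_integral_abs_sub {α : Type*} [MeasurableSpace α] {μ : Measure α}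
    {f A : ℕ → α → ℝ} {g B : α → ℝ} (hf : ∀ n, Integrable (f n) μ) (hg : Integrable g μ)
    (hA : ∀ n, Integrable (A n) μ) (hB : Integrable B μ) (hfA : ∀ n x, |f n x| ≤ A n x)
    (hgB : ∀ x, |g x| ≤ B x)
    (hfg : ∀ᵐ x ∂μ, Filter.Tendsto (fun n => f n x) Filter.atTop (𝓝 (g x)))
    (hAB : ∀ᵐ x ∂μ, Filter.Tendsto (fun n => A n x) Filter.atTop (𝓝 (B x)))
    (hint : ∀ n, ∫ x, A n x ∂μ = ∫ x, B x ∂μ) :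
    Filter.Tendsto (fun n => ∫ x, |f n x - g x| ∂μ) Filter.atTop (𝓝 0) := by
  have hi : ∀ n, Integrable (fun x => A n x + B x - |f n x - g x|) μ := fun n =>
    ((hA n).add hB).sub ((hf n).sub hg).abs
  have h0 : ∀ n x, 0 ≤ A n x + B x - |f n x - g x| := fun n x => by
    have := abs_sub (f n x) (g x)
    linarith [hfA n x, hgB x]
  -- Fatou's lemma for `A n + B - |f n - g|`, by truncating at the limit `2 * B`
  have h1 : Filter.Tendsto (fun n => ∫ x, min (A n x + B x - |f n x - g x|) (2 * B x) ∂μ)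
      Filter.atTop (𝓝 (∫ x, 2 * B x ∂μ)) := by
    refine tendsto_integral_of_dominated_convergence (fun x => 2 * B x)
      (fun n => ((hi n).inf (hB.const_mul 2)).aestronglyMeasurable) (hB.const_mul 2)
      (fun n => .of_forall fun x => ?_) ?_
    · have hB0 : 0 ≤ B x := (abs_nonneg _).trans (hgB x)
      rw [Real.norm_eq_abs, abs_of_nonneg (le_min (h0 n x) (by linarith))]
      exact min_le_right _ _
    · filter_upwards [hfg, hAB] with x hx1 hx2
      have h2 : Filter.Tendsto (fun n => A n x + B x - |f n x - g x|) Filter.atTop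
          (𝓝 (B x + B x - |g x - g x|)) :=
        (hx2.add_const _).sub ((hx1.sub_const _).abs)
      have h3 : B x + B x - |g x - g x| = 2 * B x := by simp; ring
      rw [h3] at h2
      simpa using h2.min (tendsto_const_nhds (x := 2 * B x))
  have h2 := (tendsto_const_nhds (x := ∫ x, 2 * B x ∂μ)).sub h1
  rw [sub_self] at h2
  refine squeeze_zero (fun n => integral_nonneg fun x => abs_nonneg _) (fun n => ?_) h2
  have h3 : ∫ x, min (A n x + B x - |f n x - g x|) (2 * B x) ∂μ
      ≤ ∫ x, (A n x + B x - |f n x - g x|) ∂μ :=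
    integral_mono ((hi n).inf (hB.const_mul 2)) (hi n) fun x => min_le_left _ _
  have h4 : ∫ x, (A n x + B x - |f n x - g x|) ∂μ
      = ∫ x, A n x ∂μ + ∫ x, B x ∂μ - ∫ x, |f n x - g x| ∂μ := by
    rw [← integral_add (hA n) hB]
    exact integral_sub ((hA n).add hB) ((hf n).sub hg).abs
  rw [h4, hint] at h3
  rw [integral_const_mul]
  linarith

variable {d : ℕ}

/-- A sequence of smooth bump functions on shrinking balls. -/
def mollifier (d : ℕ) (n : ℕ) : ContDiffBump (0 : E d) where
  rIn := 1 / (n + 1)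
  rOut := 2 / (n + 1)
  rIn_pos := by positivity
  rIn_lt_rOut := by gcongr; norm_num

/-- The mollification of `f`. -/
def mollify (n : ℕ) (f : E d → ℝ) : E d → ℝ :=
  convolution ((mollifier d n).normed volume) f (ContinuousLinearMap.lsmul ℝ ℝ) volume

theorem tendsto_mollifier_rOut :
    Filter.Tendsto (fun n => (mollifier d n).rOut) Filter.atTop (𝓝 0) := by
  have := (tendsto_one_div_add_atTop_nhds_zero_nat (𝕜 := ℝ)).const_mul 2
  simpa [mollifier, div_eq_mul_inv] using this

theorem ae_tendsto_mollify {f : E d → ℝ} (hf : LocallyIntegrable f) :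
    ∀ᵐ x, Filter.Tendsto (fun n => mollify n f x) Filter.atTop (𝓝 (f x)) :=
  ContDiffBump.ae_convolution_tendsto_right_of_locallyIntegrable tendsto_mollifier_rOut (K := 2)
    (.of_forall fun n => by simp [mollifier, div_eq_mul_inv]) hf

theorem mollify_eq (n : ℕ) (f : E d → ℝ) (x : E d) :
    mollify n f x = ∫ t, (mollifier d n).normed volume (x - t) * f t := by
  rw [mollify, convolution_eq_swap]
  rfl

theorem abs_mollify_le (n : ℕ) (f : E d → ℝ) (x : E d) :
    |mollify n f x| ≤ mollify n (fun y => |f y|) x := by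
  rw [mollify_eq, mollify_eq]
  refine (norm_integral_le_integral_norm (_ : E d → ℝ)).trans_eq
    (integral_congr_ae (.of_forall fun t => ?_))
  simp [abs_of_nonneg ((mollifier d n).nonneg_normed (μ := volume) (x - t))]

theorem integrable_normed_mollifier (n : ℕ) : Integrable ((mollifier d n).normed volume) :=
  (mollifier d n).integrable_normed

theorem integrable_mollify (n : ℕ) {f : E d → ℝ} (hf : Integrable f) :
    Integrable (mollify n f) :=
  (integrable_normed_mollifier n).integrable_convolution _ hf

theorem integral_mollify (n : ℕ) {f : E d → ℝ} (hf : Integrable f) :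
    ∫ x, mollify n f x = ∫ x, f x := by
  have := integral_convolution (ContinuousLinearMap.lsmul ℝ ℝ) (integrable_normed_mollifier n) hf
    (μ := volume) (ν := volume)
  rw [(mollifier d n).integral_normed] at this
  simpa [mollify] using this

theorem tendsto_integral_abs_mollify_sub {f : E d → ℝ} (hf : Integrable f) :
    Filter.Tendsto (fun n => ∫ x, |mollify n f x - f x|) Filter.atTop (𝓝 0) :=
  tendsto_integral_abs_sub (A := fun n => mollify n fun y => |f y|) (B := fun x => |f x|)
    (fun n => integrable_mollify n hf) hf (fun n => integrable_mollify n hf.abs) hf.abs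
    (fun n => abs_mollify_le n f) (fun _ => le_rfl) (ae_tendsto_mollify hf.locallyIntegrable)
    (ae_tendsto_mollify hf.abs.locallyIntegrable) fun n => integral_mollify n hf.abs

theorem contDiff_mollify (n : ℕ) {f : E d → ℝ} (hf : LocallyIntegrable f) :
    ContDiff ℝ 1 (mollify n f) :=
  (mollifier d n).hasCompactSupport_normed.contDiff_convolution_left _
    (mollifier d n).contDiff_normed hf

theorem partialDeriv_mollify (n : ℕ) {f : E d → ℝ} (hf : LocallyIntegrable f) (i : Fin d)
    (x : E d) : partialDeriv i (mollify n f) x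
      = ∫ t, f t * partialDeriv i ((mollifier d n).normed volume) (x - t) := by
  have h1 : mollify n f = convolution f ((mollifier d n).normed volume)
      (ContinuousLinearMap.lsmul ℝ ℝ).flip volume := by
    rw [mollify, convolution_flip]
  have hc : ContDiff ℝ 1 ((mollifier d n).normed (volume : Measure (E d))) :=
    (mollifier d n).contDiff_normed
  have hs := (mollifier d n).hasCompactSupport_normed (μ := (volume : Measure (E d)))
  have h2 := hs.hasFDerivAt_convolution_right (ContinuousLinearMap.lsmul ℝ ℝ).flip hf hc x
  rw [partialDeriv, h1, h2.fderiv, convolution_precompR_apply _ hf (hs.fderiv ℝ)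
    (hc.continuous_fderiv one_ne_zero), convolution_def]
  refine integral_congr_ae (.of_forall fun t => ?_)
  simp [partialDeriv, mul_comm]

variable {Ω : Set (E d)}

/-- Mollification commutes with the weak gradient away from the boundary. -/
theorem partialDeriv_mollify_indicator (hΩ : IsOpen Ω) {u : E d → ℝ} {G : E d → E d}
    (hu : HasWeakGrad Ω u G) (hi : LocallyIntegrable (Ω.indicator u)) {n : ℕ} {x : E d}
    (hx : Metric.closedBall x (mollifier d n).rOut ⊆ Ω) (i : Fin d) :
    partialDeriv i (mollify n (Ω.indicator u)) x = mollify n (Ω.indicator fun y => G y i) x := by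
  set η := (mollifier d n).normed (volume : Measure (E d)) with hη
  have hc : ContDiff ℝ ∞ η := (mollifier d n).contDiff_normed
  have hts : tsupport (fun t => η (x - t)) ⊆ Metric.closedBall x (mollifier d n).rOut := by
    refine closure_minimal (fun t ht => ?_) Metric.isClosed_closedBall
    have h1 : x - t ∈ Function.support η := ht
    rw [hη, (mollifier d n).support_normed_eq, mem_ball_zero_iff] at h1
    rw [mem_closedBall_iff_norm']
    exact h1.le
  have hζ : IsTest Ω fun t => η (x - t) :=
    ⟨hc.comp (contDiff_const.sub contDiff_id),
      .of_isClosed_subset (isCompact_closedBall _ _) (isClosed_tsupport _) hts, hts.trans hx⟩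
  have hd : ∀ t, partialDeriv i (fun t => η (x - t)) t = -partialDeriv i η (x - t) := by
    intro t
    simp only [partialDeriv]
    have h1 : HasFDerivAt (fun t => x - t) (-ContinuousLinearMap.id ℝ (E d)) t := by
      simpa using (hasFDerivAt_id t).const_sub x
    have h2 := ((hc.differentiable (by simp) (x - t)).hasFDerivAt).comp t h1
    rw [show (fun t => η (x - t)) = η ∘ fun t => x - t from rfl, h2.fderiv]
    simp
  have h1 := hu.integral_eq _ hζ i
  simp only [hd, mul_neg, integral_neg, neg_inj] at h1
  rw [partialDeriv_mollify n hi, mollify_eq]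
  have h2 : ∀ (v w : E d → ℝ), ∫ t, Ω.indicator v t * w t = ∫ t in Ω, v t * w t := by
    intro v w
    rw [← integral_indicator hΩ.measurableSet]
    refine integral_congr_ae (.of_forall fun t => ?_)
    by_cases ht : t ∈ Ω <;> simp [ht]
  rw [h2, h1, ← h2]
  simp only [mul_comm, ← hη]

/-- The chain rule for weak gradients. The function `u` is mollified after extension by zero: on
the support of a test function, which has a positive distance to the boundary, the classical chain
rule applies to the mollified function. -/
theorem HasWeakGrad.comp (hΩ : IsOpen Ω) {u : E d → ℝ} {G : E d → E d}
    (hu : HasWeakGrad Ω u G) (hui : Integrable u (volume.restrict Ω))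
    (hGi : Integrable G (volume.restrict Ω)) (hfin : IsFiniteMeasure (volume.restrict Ω))
    {k : ℝ → ℝ} (hk : ContDiff ℝ 1 k) {C : ℝ}
    (hkC : ∀ s, |k s| ≤ C) (hkC' : ∀ s, |deriv k s| ≤ C) :
    HasWeakGrad Ω (fun x => k (u x)) fun x => deriv k (u x) • G x where
  locallyIntegrableOn := by
    refine locallyIntegrableOn_of_restrict (Integrable.locallyIntegrable ?_)
    exact Integrable.of_bound (hk.continuous.comp_aestronglyMeasurable hui.1) C
      (.of_forall fun x => hkC _)
  locallyIntegrableOn_grad := by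
    refine locallyIntegrableOn_of_restrict (Integrable.locallyIntegrable ?_)
    exact hGi.bdd_smul C ((hk.continuous_deriv le_rfl).comp_aestronglyMeasurable hui.1)
      (.of_forall fun x => hkC' _)
  integral_eq ζ hζ i := by
    have hC : 0 ≤ C := (abs_nonneg _).trans (hkC 0)
    set Φ := Ω.indicator u with hΦ
    set Γ := Ω.indicator fun y => G y i with hΓ
    have hΦi : Integrable Φ := (integrable_indicator_iff hΩ.measurableSet).2 hui
    have hΓi : Integrable Γ := (integrable_indicator_iff hΩ.measurableSet).2
      ((EuclideanSpace.proj (𝕜 := ℝ) i).integrable_comp hGi)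
    have hk' : Continuous (deriv k) := hk.continuous_deriv le_rfl
    have hcΦ := fun n => contDiff_mollify n hΦi.locallyIntegrable
    have haeΦ := ae_tendsto_mollify hΦi.locallyIntegrable
    obtain ⟨Cζ, hCζ⟩ := hζ.contDiff.continuous.bounded_above_of_compact_support
      hζ.hasCompactSupport
    have hCζ0 : 0 ≤ Cζ := (norm_nonneg _).trans (hCζ 0)
    have hdi : Integrable (Nanofluid.partialDeriv i ζ) :=
      (hζ.partialDeriv i).contDiff.continuous.integrable_of_hasCompactSupport
        (hζ.partialDeriv i).hasCompactSupport
    -- integration by parts for the mollified function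
    have hibp : ∀ᶠ n in Filter.atTop, ∫ x, k (mollify n Φ x) * Nanofluid.partialDeriv i ζ x
        = -∫ x, deriv k (mollify n Φ x) * mollify n Γ x * ζ x := by
      obtain ⟨δ, hδ, hδΩ⟩ := hζ.hasCompactSupport.isCompact.exists_cthickening_subset_open hΩ
        hζ.tsupport_subset
      filter_upwards [(tendsto_mollifier_rOut (d := d)).eventually (gt_mem_nhds hδ)] with n hn
      refine (hζ.integral_mul_partialDeriv (hk.comp (hcΦ n)) i).trans ?_
      congr 1
      refine integral_congr_ae (.of_forall fun x => ?_)
      by_cases hx : x ∈ tsupport ζ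
      · have hball : Metric.closedBall x (mollifier d n).rOut ⊆ Ω :=
          (Metric.closedBall_subset_cthickening hx _).trans
            ((Metric.cthickening_mono hn.le _).trans hδΩ)
        have h1 := partialDeriv_mollify_indicator hΩ hu hΦi.locallyIntegrable hball i
        have h2 : Nanofluid.partialDeriv i (k ∘ mollify n Φ) x
            = deriv k (mollify n Φ x) * Nanofluid.partialDeriv i (mollify n Φ) x := by
          have h3 := ((hk.differentiable one_ne_zero _).hasDerivAt).comp_hasFDerivAt x
            (((hcΦ n).differentiable one_ne_zero x).hasFDerivAt)
          simp only [Nanofluid.partialDeriv]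
          rw [h3.fderiv]
          simp
        change Nanofluid.partialDeriv i (k ∘ mollify n Φ) x * ζ x = _
        rw [h2, h1]
      · simp [image_eq_zero_of_notMem_tsupport hx]
    have hlim1 : Filter.Tendsto (fun n => ∫ x, k (mollify n Φ x) * Nanofluid.partialDeriv i ζ x)
        Filter.atTop (𝓝 (∫ x, k (Φ x) * Nanofluid.partialDeriv i ζ x)) := by
      refine tendsto_integral_of_dominated_convergence
        (fun x => C * ‖Nanofluid.partialDeriv i ζ x‖)
        (fun n => ((hk.continuous.comp (hcΦ n).continuous).aestronglyMeasurable).mul hdi.1)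
        (hdi.norm.const_mul C) (fun n => .of_forall fun x => ?_) ?_
      · rw [norm_mul]
        gcongr
        exact hkC _
      · filter_upwards [haeΦ] with x hx
        exact ((hk.continuous.tendsto _).comp hx).mul_const _
    have hdm : ∀ n, AEStronglyMeasurable (fun x => deriv k (mollify n Φ x)) volume := fun n =>
      (hk'.comp (hcΦ n).continuous).aestronglyMeasurable
    have hζm : AEStronglyMeasurable ζ volume := hζ.contDiff.continuous.aestronglyMeasurable
    -- `k'(Φₙ)Γₙ → k'(Φ)Γ`: the factor `k'(Φₙ)` converges boundedly almost everywhere, the factor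
    -- `Γₙ` converges in `L_1`
    have hlim2 : Filter.Tendsto (fun n => ∫ x, deriv k (mollify n Φ x) * Γ x * ζ x)
        Filter.atTop (𝓝 (∫ x, deriv k (Φ x) * Γ x * ζ x)) := by
      refine tendsto_integral_of_dominated_convergence (fun x => C * ‖Γ x‖ * Cζ)
        (fun n => ((hdm n).mul hΓi.1).mul hζm)
        ((hΓi.norm.const_mul C).mul_const Cζ) (fun n => .of_forall fun x => ?_) ?_
      · rw [norm_mul, norm_mul]
        gcongr
        exacts [hkC' _, hCζ x]
      · filter_upwards [haeΦ] with x hx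
        exact (((hk'.tendsto _).comp hx).mul_const _).mul_const _
    have hint : ∀ n {g : E d → ℝ}, Integrable g →
        Integrable fun x => deriv k (mollify n Φ x) * g x * ζ x := fun n g hg =>
      (hg.bdd_mul (c := C) (hdm n) (.of_forall fun x => hkC' _)).mul_bdd (c := Cζ) hζm
        (.of_forall hCζ)
    have hlim3 : Filter.Tendsto
        (fun n => ∫ x, deriv k (mollify n Φ x) * (mollify n Γ x - Γ x) * ζ x)
        Filter.atTop (𝓝 0) := by
      have h1 := (tendsto_integral_abs_mollify_sub hΓi).const_mul (C * Cζ)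
      rw [mul_zero] at h1
      refine squeeze_zero_norm (fun n => ?_) h1
      rw [← integral_const_mul]
      refine (norm_integral_le_integral_norm _).trans (integral_mono
        (hint n ((integrable_mollify n hΓi).sub hΓi)).norm
        (((integrable_mollify n hΓi).sub hΓi).abs.const_mul _) fun x => ?_)
      dsimp only
      rw [norm_mul, norm_mul, mul_right_comm]
      gcongr
      exacts [hkC' _, hCζ x, le_rfl]
    have hlim4 : Filter.Tendsto (fun n => ∫ x, deriv k (mollify n Φ x) * mollify n Γ x * ζ x)
        Filter.atTop (𝓝 (∫ x, deriv k (Φ x) * Γ x * ζ x)) := by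
      have h1 := hlim2.add hlim3
      rw [add_zero] at h1
      refine h1.congr fun n => ?_
      refine (integral_add (hint n hΓi) (hint n ((integrable_mollify n hΓi).sub hΓi))).symm.trans ?_
      refine integral_congr_ae (.of_forall fun x => ?_)
      simp only [Pi.sub_apply]
      ring
    have hfinal := tendsto_nhds_unique (hlim1.congr' hibp) hlim4.neg
    rw [← (hζ.partialDeriv i).setIntegral_mul, ← hζ.setIntegral_mul] at hfinal
    calc _ = _ := setIntegral_congr_fun hΩ.measurableSet fun x hx => by simp [hΦ, hx]
      _ = _ := hfinal
      _ = _ := congrArg Neg.neg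
        (setIntegral_congr_fun hΩ.measurableSet fun x hx => by simp [hΦ, hΓ, hx])

end Mollification

/-! ### Products with functions vanishing on the boundary -/

section Product

variable {d : ℕ} {Ω : Set (E d)} {p : ℝ≥0∞} [Fact (1 ≤ p)]

/-- Integration against a function in the dual Lebesgue space is a continuous functional. -/
theorem LinearInLp.exists_integral_mul {α Y : Type*} [MeasurableSpace α] {μ : Measure α}
    [NormedAddCommGroup Y] [NormedSpace ℝ Y] {a b : ℝ≥0∞} [Fact (1 ≤ a)] [Fact (1 ≤ b)]
    [ENNReal.HolderConjugate a b] {e : Y → α → ℝ} (he : LinearInLp μ b e) {w : α → ℝ}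
    (hw : MemLp w a μ) :
    ∃ A : Y →L[ℝ] ℝ, ∀ V, Integrable (fun x => w x * e V x) μ ∧ A V = ∫ x, w x * e V x ∂μ := by
  obtain ⟨T, -, -, h, -⟩ := (SmoothInLp.const (X := ℝ) hw).pair he
  exact ⟨T 0, fun V => h 0 V⟩

/-- A closed property holds on the closure of the test functions if it holds for test functions. -/
theorem Sobolev0.induction {P : Sobolev0 Ω p → Prop} (hP : IsClosed {u | P u})
    (h : ∀ u : Sobolev0 Ω p, u.toSobolev ∈ testFunctions Ω p → P u) (u : Sobolev0 Ω p) : P u := by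
  obtain ⟨w, hw, hlim⟩ := mem_closure_iff_seq_limit.1
    (show u.toSobolev ∈ closure (testFunctions Ω p : Set (Sobolev Ω p)) from u.2)
  let v : ℕ → Sobolev0 Ω p := fun n => ⟨w n, subset_closure (hw n)⟩
  have hv : Filter.Tendsto v Filter.atTop (𝓝 u) := tendsto_subtype_rng.2 hlim
  exact hP.mem_of_tendsto hv (.of_forall fun n => h (v n) (hw n))

/-- The product rule for a bounded function and an element of the closure of the test functions. -/
theorem HasWeakGrad.mul_sobolev0 (hΩ : IsOpen Ω) [IsFiniteMeasure (volume.restrict Ω)]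
    {p' : ℝ≥0∞} [Fact (1 ≤ p')] [p'.HolderConjugate p] (hpp : p' ≤ p) {u : E d → ℝ}
    {G : E d → E d} (hu : HasWeakGrad Ω u G) (hum : MemLp u ⊤ (volume.restrict Ω))
    (hG : MemLp G p (volume.restrict Ω)) (v : Sobolev0 Ω p) :
    HasWeakGrad Ω (fun x => u x * v.fn x) fun x => u x • v.grad x + v.fn x • G x where
  locallyIntegrableOn := by
    refine locallyIntegrableOn_of_restrict (Integrable.locallyIntegrable ?_)
    exact ((v.toSobolev.memLp_fn.mul (r := p) hum)).integrable Fact.out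
  locallyIntegrableOn_grad := by
    refine locallyIntegrableOn_of_restrict (Integrable.locallyIntegrable (.add ?_ ?_))
    · exact (v.toSobolev.memLp_grad.smul (r := p) hum).integrable Fact.out
    · exact memLp_one_iff_integrable.1 (MemLp.smul (r := 1) (p := p) (q := p')
        (hG.mono_exponent hpp) v.toSobolev.memLp_fn)
  integral_eq ζ hζ i := by
    have hGp : MemLp (fun x => G x i) p' (volume.restrict Ω) :=
      (hG.mono_exponent hpp).eval_piLp i
    have hup : MemLp u p' (volume.restrict Ω) := hum.mono_exponent le_top
    have htop : ∀ {ξ : E d → ℝ}, IsTest Ω ξ → MemLp ξ ⊤ (volume.restrict Ω) := by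
      intro ξ hξ
      obtain ⟨C, hC⟩ := hξ.contDiff.continuous.bounded_above_of_compact_support
        hξ.hasCompactSupport
      exact memLp_top_of_bound hξ.contDiff.continuous.aestronglyMeasurable C (.of_forall hC)
    obtain ⟨A₁, hA₁⟩ := (linearInLp_fn (Ω := Ω) (p := p)).exists_integral_mul
      ((htop (hζ.partialDeriv i)).mul (r := p') hup)
    obtain ⟨A₂, hA₂⟩ := (linearInLp_fn (Ω := Ω) (p := p)).exists_integral_mul
      ((htop hζ).mul (r := p') hGp)
    obtain ⟨A₃, hA₃⟩ := (linearInLp_grad (Ω := Ω) (p := p) i).exists_integral_mul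
      ((htop hζ).mul (r := p') hup)
    -- the identity is closed in `v`, and for test functions `v` it is the definition of the weak
    -- gradient of `u`, tested with `v ζ`
    have key : A₁ v + (A₂ v + A₃ v) = 0 := by
      refine Sobolev0.induction (P := fun v => A₁ v + (A₂ v + A₃ v) = 0)
        (isClosed_eq (by fun_prop) continuous_const) ?_ v
      rintro v ⟨θ, hθ, hv⟩
      have hgrad := v.toSobolev.hasWeakGrad.ae_eq hΩ hθ.hasWeakGrad hv
      have hprod : IsTest Ω fun x => θ x * ζ x := ⟨hθ.contDiff.mul hζ.contDiff,
        hζ.hasCompactSupport.mul_left, (tsupport_mul_subset_right).trans hζ.tsupport_subset⟩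
      have hd : ∀ x, Nanofluid.partialDeriv i (fun x => θ x * ζ x) x
          = θ x * Nanofluid.partialDeriv i ζ x + Nanofluid.partialDeriv i θ x * ζ x := by
        intro x
        have := ((hθ.contDiff.differentiable (by simp) x).hasFDerivAt).mul
          ((hζ.contDiff.differentiable (by simp) x).hasFDerivAt)
        simp only [Nanofluid.partialDeriv]
        rw [show (fun x => θ x * ζ x) = θ * ζ from rfl, this.fderiv]
        simp [mul_comm]
      have h1 := hu.integral_eq _ hprod i
      have e1 : ∫ x in Ω, u x * Nanofluid.partialDeriv i (fun x => θ x * ζ x) x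
          = A₁ v + A₃ v := by
        rw [(hA₁ v).2, (hA₃ v).2, ← integral_add (hA₁ v).1 (hA₃ v).1]
        refine integral_congr_ae ?_
        filter_upwards [hv, hgrad] with x hx1 hx2
        have hx1' : v.fn x = θ x := hx1
        have hx2' : v.grad x = gradient θ x := hx2
        simp only [hd, Pi.mul_apply, hx1', hx2', ← partialDeriv_eq_gradient]
        ring
      have e2 : ∫ x in Ω, G x i * (θ x * ζ x) = A₂ v := by
        rw [(hA₂ v).2]
        refine integral_congr_ae ?_
        filter_upwards [hv] with x hx1
        have hx1' : v.fn x = θ x := hx1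
        simp only [Pi.mul_apply, hx1']
        ring
      linarith
    rw [(hA₁ v).2, (hA₂ v).2, (hA₃ v).2, ← integral_add (hA₂ v).1 (hA₃ v).1] at key
    have h1 : ∫ x in Ω, u x * v.fn x * Nanofluid.partialDeriv i ζ x
        = ∫ x in Ω, (u * Nanofluid.partialDeriv i ζ) x * v.fn x := by
      congr 1 with x
      simp only [Pi.mul_apply]
      ring
    have h2 : ∫ x in Ω, (u x • v.grad x + v.fn x • G x) i * ζ x
        = ∫ x in Ω, (((fun x => G x i) * ζ) x * v.fn x + (u * ζ) x * v.grad x i) := by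
      congr 1 with x
      simp only [Pi.mul_apply, PiLp.add_apply, PiLp.smul_apply, smul_eq_mul]
      ring
    rw [h1, h2]
    linarith

end Product

/-! ### Exponents -/

section Exponents

instance fact_one_le_three : Fact ((1 : ℝ≥0∞) ≤ 3) := ⟨by norm_num⟩

instance fact_one_le_six : Fact ((1 : ℝ≥0∞) ≤ 6) := ⟨by norm_num⟩

theorem toReal_inv_add {a b : ℝ≥0∞} (ha : a ≠ 0) (hb : b ≠ 0) :
    (a⁻¹ + b⁻¹).toReal = a.toReal⁻¹ + b.toReal⁻¹ := by
  rw [ENNReal.toReal_add (by simpa) (by simpa), ENNReal.toReal_inv, ENNReal.toReal_inv]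

/-- The exponent `m` with `1/m = 1/3 + 1/2` of a product of functions in `L_3` and `L_2`, which is
dual to `L_6`. -/
theorem exists_exponent_three_two : ∃ m : ℝ≥0∞, 1 ≤ m ∧ ENNReal.HolderTriple 3 2 m ∧
    m.HolderConjugate 6 := by
  have h : (3⁻¹ + 2⁻¹ : ℝ≥0∞) + 6⁻¹ = 1 := by
    rw [← ENNReal.toReal_eq_toReal_iff' (by simp) (by simp), ENNReal.toReal_add (by simp) (by simp),
      toReal_inv_add (by simp) (by simp)]
    norm_num
  refine ⟨(3⁻¹ + 2⁻¹)⁻¹, ?_, ⟨by simp⟩, ⟨by simpa using h⟩⟩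
  rw [ENNReal.one_le_inv]
  exact le_self_add.trans h.le

/-- The exponent `m` with `1/m = 1/3 + 1/p` of a product of functions in `L_3` and `L_p`, and its
dual exponent `s`, the Sobolev exponent of `p'` in dimension three. -/
theorem exists_exponents {p p' : ℝ≥0∞} (hp : 3 < p) (hp_top : p ≠ ⊤)
    (hpp' : p.HolderConjugate p') : ∃ (m s : ℝ≥0∞) (r : NNReal), 1 ≤ m ∧ 1 ≤ s ∧
      ENNReal.HolderTriple 3 p m ∧ m.HolderConjugate s ∧ s ≠ ⊤ ∧ p' = r ∧ 1 ≤ r ∧ r < 2 ∧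
      (r : ℝ)⁻¹ - 3⁻¹ ≤ s.toReal⁻¹ ∧ p' ≤ p := by
  have hp0 : p ≠ 0 := (pos_of_gt hp).ne'
  have hp3 : (3 : ℝ) < p.toReal := by
    simpa using (ENNReal.toReal_lt_toReal (by simp) hp_top).2 hp
  have hp3' : p.toReal⁻¹ < 3⁻¹ := by gcongr
  have hsum : p⁻¹ + p'⁻¹ = 1 := hpp'.inv_add_inv_eq_one
  have hp'_top : p' ≠ ⊤ := by
    rintro rfl
    rw [ENNReal.inv_top, add_zero, ENNReal.inv_eq_one] at hsum
    exact absurd hp (by rw [hsum]; norm_num)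
  have hp'0 : p' ≠ 0 := fun h => by simp [h] at hsum
  have hsum' : p.toReal⁻¹ + p'.toReal⁻¹ = 1 := by
    rw [← toReal_inv_add hp0 hp'0, hsum, ENNReal.toReal_one]
  have ha : (3⁻¹ + p⁻¹ : ℝ≥0∞).toReal = 3⁻¹ + p.toReal⁻¹ := by
    rw [toReal_inv_add (by simp) hp0, ENNReal.toReal_ofNat]
  have ha_top : (3⁻¹ + p⁻¹ : ℝ≥0∞) ≠ ⊤ := by simp [hp0]
  have ha1 : (3⁻¹ + p⁻¹ : ℝ≥0∞) < 1 := by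
    rw [← ENNReal.toReal_lt_toReal ha_top (by simp), ha, ENNReal.toReal_one]
    linarith
  have hpp : p'.toReal ≤ 2 := by
    have h1 : (2 : ℝ)⁻¹ ≤ p'.toReal⁻¹ := by linarith
    exact (inv_le_inv₀ (by norm_num) (ENNReal.toReal_pos hp'0 hp'_top)).1 h1
  have hle : p' ≤ p := (ENNReal.toReal_le_toReal hp'_top hp_top).1 (by linarith)
  lift p' to NNReal using hp'_top
  have hr0 : 0 < (p' : ℝ) := by
    rw [NNReal.coe_pos, pos_iff_ne_zero]
    simpa using hp'0
  rw [ENNReal.coe_toReal] at hsum' hpp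
  have hpi : 0 < p.toReal⁻¹ := by rw [inv_pos]; linarith
  refine ⟨(3⁻¹ + p⁻¹)⁻¹, (1 - (3⁻¹ + p⁻¹))⁻¹, p', ?_, ?_, ⟨by simp⟩, .inv_one_sub_inv ha1.le, ?_,
    rfl, ?_, ?_, ?_, hle⟩
  · exact ENNReal.one_le_inv.2 ha1.le
  · exact ENNReal.one_le_inv.2 tsub_le_self
  · rw [Ne, ENNReal.inv_eq_top, tsub_eq_zero_iff_le, not_le]
    exact ha1
  · rw [← NNReal.coe_le_coe, NNReal.coe_one]
    exact (one_le_inv₀ (inv_pos.2 hr0)).2 (by linarith) |>.trans_eq (inv_inv _)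
  · rw [← NNReal.coe_lt_coe, NNReal.coe_ofNat]
    refine (inv_lt_inv₀ (by norm_num) hr0).1 ?_
    linarith
  · rw [ENNReal.toReal_inv, inv_inv, ENNReal.toReal_sub_of_le ha1.le (by simp), ha,
      ENNReal.toReal_one]
    linarith

end Exponents

/-! ### The components of the unknowns and test functions -/

section Components

variable {d : ℕ} {Ω : Set (E d)}

/-- The component `uᵢ` as a continuous linear map. -/
def velocityComp (i : Fin d) : Velocity Ω →L[ℝ] Sobolev0 Ω 2 :=
  (PiLp.proj 2 (fun _ : Fin d => Sobolev0 Ω 2) i :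
    PiLp 2 (fun _ : Fin d => Sobolev0 Ω 2) →L[ℝ] Sobolev0 Ω 2)

theorem linearInLp_velocity (hd : d = 2 ∨ d = 3) (hΩ : IsOpen Ω) (hb : Bornology.IsBounded Ω)
    (i : Fin d) : LinearInLp (volume.restrict Ω) 6 fun (u : Velocity Ω) x => u.fn x i := by
  have h : LinearInLp (volume.restrict Ω) 6 fun u : Sobolev0 Ω 2 => u.fn := by
    rcases hd with rfl | rfl
    -- `6` is the Sobolev exponent of `3 / 2` in dimension two and of `2` in dimension three
    · refine linearInLp_sobolev hΩ hb (r := 3 / 2) (by simp) ?_ ?_ ?_ ?_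
      · rw [← NNReal.coe_le_coe]; norm_num
      · rw [← ENNReal.coe_ofNat, ENNReal.coe_le_coe, ← NNReal.coe_le_coe]; norm_num
      · rw [← NNReal.coe_lt_coe]; norm_num
      · norm_num
    · refine linearInLp_sobolev hΩ hb (r := 2) (by simp) ?_ ?_ ?_ ?_
      · norm_num
      · norm_num
      · norm_num
      · norm_num
  exact h.comp (velocityComp i)

theorem linearInLp_velocity_grad (i j : Fin d) :
    LinearInLp (volume.restrict Ω) 2 fun (u : Velocity Ω) x => (u.comp i).grad x j :=
  (linearInLp_grad j).comp (velocityComp i)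

theorem linearInLp_symGrad (i j : Fin d) :
    LinearInLp (volume.restrict Ω) 2 fun (u : Velocity Ω) x => u.symGrad x i j :=
  (linearInLp_velocity_grad j i).add (linearInLp_velocity_grad i j)

theorem linearInLp_div :
    LinearInLp (volume.restrict Ω) 2 fun (u : Velocity Ω) x => u.div x :=
  LinearInLp.sum _ fun i _ => linearInLp_velocity_grad i i

theorem linearInLp_pressure :
    LinearInLp (volume.restrict Ω) 2 fun (q : Pressure Ω) => q.fn :=
  LinearInLp.id.comp ((zeroMean Ω).subtypeL : Pressure Ω →L[ℝ] LpR Ω 2)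

variable {p : ℝ≥0∞} [Fact (1 ≤ p)]

/-- The projection onto the first factor of the product space. -/
def proj₁ : Space Ω p →L[ℝ] Sobolev0 Ω p := .fst ℝ _ _

/-- The projection onto the second factor of the product space. -/
def proj₂ : Space Ω p →L[ℝ] Sobolev0 Ω p := (ContinuousLinearMap.fst ℝ _ _).comp (.snd ℝ _ _)

/-- The projection onto the third factor of the product space. -/
def proj₃ : Space Ω p →L[ℝ] Velocity Ω :=
  (ContinuousLinearMap.fst ℝ _ _).comp ((ContinuousLinearMap.snd ℝ _ _).comp (.snd ℝ _ _))

/-- The projection onto the fourth factor of the product space. -/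
def proj₄ : Space Ω p →L[ℝ] Pressure Ω :=
  (ContinuousLinearMap.snd ℝ _ _).comp ((ContinuousLinearMap.snd ℝ _ _).comp (.snd ℝ _ _))

theorem linearInLp_fst_grad (i : Fin d) :
    LinearInLp (volume.restrict Ω) p fun (U : Space Ω p) x => U.1.grad x i :=
  (linearInLp_grad i).comp proj₁

theorem linearInLp_snd_grad (i : Fin d) :
    LinearInLp (volume.restrict Ω) p fun (U : Space Ω p) x => U.2.1.grad x i :=
  (linearInLp_grad i).comp proj₂

theorem LinearInLp.space_fst {q : ℝ≥0∞} [Fact (1 ≤ q)]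
    (h : LinearInLp (volume.restrict Ω) q fun u : Sobolev0 Ω p => u.fn) :
    LinearInLp (volume.restrict Ω) q fun (U : Space Ω p) => U.1.fn :=
  h.comp proj₁

theorem LinearInLp.space_snd {q : ℝ≥0∞} [Fact (1 ≤ q)]
    (h : LinearInLp (volume.restrict Ω) q fun u : Sobolev0 Ω p => u.fn) :
    LinearInLp (volume.restrict Ω) q fun (U : Space Ω p) => U.2.1.fn :=
  h.comp proj₂

theorem LinearInLp.space_velocity {q : ℝ≥0∞} [Fact (1 ≤ q)] {e : Velocity Ω → E d → ℝ}
    (h : LinearInLp (volume.restrict Ω) q e) :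
    LinearInLp (volume.restrict Ω) q fun (U : Space Ω p) => e U.2.2.1 :=
  h.comp proj₃

theorem linearInLp_space_pressure :
    LinearInLp (volume.restrict Ω) 2 fun (U : Space Ω p) => U.2.2.2.fn :=
  linearInLp_pressure.comp proj₄

variable (D : Data Ω p)

theorem phi_fn_ae (U : Space Ω p) :
    (fun x => D.φD.fn x + U.1.fn x) =ᵐ[volume.restrict Ω] (D.phi U).fn :=
  (Sobolev.fn_add D.φD U.1.toSobolev).symm

theorem phi_grad_ae (U : Space Ω p) (i : Fin d) :
    (fun x => D.φD.grad x i + U.1.grad x i) =ᵐ[volume.restrict Ω] fun x => (D.phi U).grad x i :=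
  ((Sobolev.grad_add D.φD U.1.toSobolev).fun_comp fun z : E d => z i).symm

theorem memLp_φD : MemLp D.φD.fn ⊤ (volume.restrict Ω) := by
  refine memLp_top_of_bound D.φD.memLp_fn.1 1 ?_
  filter_upwards [D.φD_mem] with x hx
  rw [Real.norm_eq_abs, abs_of_nonneg hx.1]
  exact hx.2

variable {D}

theorem smooth_phi (hT : LinearInLp (volume.restrict Ω) ⊤ fun u : Sobolev0 Ω p => u.fn) :
    SmoothInLp (volume.restrict Ω) ⊤ (fun U : Space Ω p => (D.phi U).fn) fun _ W => W.1.fn := by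
  refine ((SmoothInLp.const (memLp_φD D)).add hT.space_fst.smooth).congr (phi_fn_ae D)
    fun U W => .of_forall fun x => ?_
  exact zero_add _

theorem smooth_phi_grad (i : Fin d) : SmoothInLp (volume.restrict Ω) p
    (fun (U : Space Ω p) x => (D.phi U).grad x i) fun _ W x => W.1.grad x i := by
  refine ((SmoothInLp.const (D.φD.memLp_grad.eval_piLp i)).add
    (linearInLp_fst_grad i).smooth).congr (phi_grad_ae D · i)
    fun U W => .of_forall fun x => ?_
  exact zero_add _

/-- The convecting field `j + ρu` is a smooth function of the unknowns with values in `L_3`. -/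
theorem smooth_convecting_field [IsFiniteMeasure (volume.restrict Ω)] (hp : 3 ≤ p)
    (hT : LinearInLp (volume.restrict Ω) ⊤ fun u : Sobolev0 Ω p => u.fn)
    (hu : ∀ i, LinearInLp (volume.restrict Ω) 6 fun (u : Velocity Ω) x => u.fn x i) (i : Fin d) :
    SmoothInLp (volume.restrict Ω) 3
      (fun (U : Space Ω p) x => (D.flux U x + (1 + (D.phi U).fn x) • U.2.2.1.fn x) i)
      fun U W x => (D.fluxDeriv U W x + W.1.fn x • U.2.2.1.fn x
        + (1 + (D.phi U).fn x) • W.2.2.1.fn x) i := by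
  have hh := ((smooth_phi (D := D) hT).superpose D.contDiff_h).mul (c := p)
    (linearInLp_snd_grad i).smooth
  have hj := ((smooth_phi_grad (D := D) i).neg.add hh.neg).mono hp
  have hu3 := ((hu i).space_velocity (p := p)).smooth.mono (a := 3) (by norm_num)
  have h1 : MemLp (fun _ : E d => (1 : ℝ)) ⊤ (volume.restrict Ω) := memLp_const 1
  have hr := ((SmoothInLp.const h1).add (smooth_phi (D := D) hT)).mul (c := 3) hu3
  refine (hj.add hr).congr (fun U => .of_forall fun x => ?_) fun U W => .of_forall fun x => ?_
  · simp [Data.flux]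
    ring
  · simp [Data.fluxDeriv]
    ring

end Components

/-! ### The terms of the form -/

/-!
Each lemma treats one entry of `Data.terms`. Its derivative is the sum of the one or two entries of
`Data.derivTerms` that arise from it; the terms without unknowns have derivative zero.
-/

section Terms

variable {d : ℕ} {Ω : Set (E d)} {p p' : ℝ≥0∞} [Fact (1 ≤ p)] [Fact (1 ≤ p')] {D : Data Ω p}

theorem inner_eq_sum (a b : E d) : ⟪a, b⟫ = ∑ i, a i * b i := by
  simp [PiLp.inner_apply, mul_comm]

theorem smoothForm_diffusion [p.HolderConjugate p'] : SmoothForm (volume.restrict Ω)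
    (fun (U : Space Ω p) (V : Space Ω p') => D.terms U V 0) fun U W V => D.derivTerms U W V 0 := by
  refine (SmoothForm.sum Finset.univ fun i _ =>
    (smooth_phi_grad (D := D) i).pair (linearInLp_fst_grad (p := p') i)).congr
    (fun U V => .of_forall fun x => ?_) fun U W V => .of_forall fun x => ?_
  · exact (inner_eq_sum _ _).symm
  · exact (inner_eq_sum _ _).symm

theorem smoothForm_thermodiffusion [p.HolderConjugate p']
    (hT : LinearInLp (volume.restrict Ω) ⊤ fun u : Sobolev0 Ω p => u.fn) :
    SmoothForm (volume.restrict Ω) (fun (U : Space Ω p) (V : Space Ω p') => D.terms U V 1)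
      fun U W V x => D.derivTerms U W V 1 x + D.derivTerms U W V 2 x := by
  refine (SmoothForm.sum Finset.univ fun i _ =>
    (((smooth_phi (D := D) hT).superpose D.contDiff_h).mul (c := p)
      (linearInLp_snd_grad i).smooth).pair (linearInLp_fst_grad (p := p') i)).congr
    (fun U V => .of_forall fun x => ?_) fun U W V => .of_forall fun x => ?_
  · change _ = D.h ((D.phi U).fn x) * ⟪U.2.1.grad x, V.1.grad x⟫
    simp only [inner_eq_sum, Finset.mul_sum, mul_assoc]
  · change _ = deriv D.h ((D.phi U).fn x) * W.1.fn x * ⟪U.2.1.grad x, V.1.grad x⟫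
      + D.h ((D.phi U).fn x) * ⟪W.2.1.grad x, V.1.grad x⟫
    simp only [inner_eq_sum, Finset.mul_sum, mul_assoc, add_mul, Finset.sum_add_distrib]

theorem smoothForm_transport {m s : ℝ≥0∞} [Fact (1 ≤ m)] [Fact (1 ≤ s)]
    [ENNReal.HolderTriple 3 p m] [m.HolderConjugate s] [IsFiniteMeasure (volume.restrict Ω)]
    (hu : ∀ i, LinearInLp (volume.restrict Ω) 6 fun (u : Velocity Ω) x => u.fn x i)
    (hψ : LinearInLp (volume.restrict Ω) s fun u : Sobolev0 Ω p' => u.fn) :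
    SmoothForm (volume.restrict Ω) (fun (U : Space Ω p) (V : Space Ω p') => D.terms U V 2)
      fun U W V x => D.derivTerms U W V 3 x + D.derivTerms U W V 4 x := by
  refine ((SmoothInLp.sum Finset.univ fun i _ =>
    ((hu i).space_velocity.smooth.mono (a := 3) (by norm_num)).mul (c := m)
      (smooth_phi_grad (D := D) i)).pair hψ.space_fst).congr
    (fun U V => .of_forall fun x => ?_) fun U W V => .of_forall fun x => ?_
  · change _ = ⟪U.2.2.1.fn x, (D.phi U).grad x⟫ * V.1.fn x
    simp only [inner_eq_sum]
  · change _ = ⟪U.2.2.1.fn x, W.1.grad x⟫ * V.1.fn x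
      + ⟪W.2.2.1.fn x, (D.phi U).grad x⟫ * V.1.fn x
    simp only [inner_eq_sum, Finset.sum_add_distrib]
    ring

/-- The heat flux `k(φ)∇T`. Its derivative `k'(φ)χ∇T + k(φ)∇Θ` is rewritten with the product
rule for `∇(k(φ)Θ)`. -/
theorem smoothForm_conduction [p.HolderConjugate p'] (hΩ : IsOpen Ω)
    (hT : LinearInLp (volume.restrict Ω) ⊤ fun u : Sobolev0 Ω p => u.fn)
    (hk : ∀ U W : Space Ω p, HasWeakGrad Ω (fun x => D.k ((D.phi U).fn x) * W.2.1.fn x)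
      fun x => D.k ((D.phi U).fn x) • W.2.1.grad x
        + W.2.1.fn x • deriv D.k ((D.phi U).fn x) • (D.phi U).grad x) :
    SmoothForm (volume.restrict Ω) (fun (U : Space Ω p) (V : Space Ω p') => D.terms U V 3)
      fun U W V x => D.derivTerms U W V 5 x + D.derivTerms U W V 6 x := by
  refine (SmoothForm.sum Finset.univ fun i _ =>
    (((smooth_phi (D := D) hT).superpose D.contDiff_k).mul (c := p)
      (linearInLp_snd_grad i).smooth).pair (linearInLp_snd_grad (p := p') i)).congr
    (fun U V => .of_forall fun x => ?_) fun U W V => ?_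
  · change _ = D.k ((D.phi U).fn x) * ⟪U.2.1.grad x, V.2.1.grad x⟫
    simp only [inner_eq_sum, Finset.mul_sum, mul_assoc]
  · filter_upwards [weakGrad_ae_eq hΩ (hk U W)] with x hx
    change _ = ⟪weakGrad Ω (fun y => D.k ((D.phi U).fn y) * W.2.1.fn y) x, V.2.1.grad x⟫
      + deriv D.k ((D.phi U).fn x)
        * ⟪W.1.fn x • U.2.1.grad x - W.2.1.fn x • (D.phi U).grad x, V.2.1.grad x⟫
    rw [hx]
    simp only [inner_eq_sum, Finset.mul_sum, ← Finset.sum_add_distrib, PiLp.add_apply,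
      PiLp.sub_apply, PiLp.smul_apply, smul_eq_mul]
    refine Finset.sum_congr rfl fun i _ => ?_
    ring

theorem smoothForm_heat_convection {m s : ℝ≥0∞} [Fact (1 ≤ m)] [Fact (1 ≤ s)]
    [ENNReal.HolderTriple 3 p m] [m.HolderConjugate s] [IsFiniteMeasure (volume.restrict Ω)]
    (hp : 3 ≤ p) (hT : LinearInLp (volume.restrict Ω) ⊤ fun u : Sobolev0 Ω p => u.fn)
    (hu : ∀ i, LinearInLp (volume.restrict Ω) 6 fun (u : Velocity Ω) x => u.fn x i)
    (hψ : LinearInLp (volume.restrict Ω) s fun u : Sobolev0 Ω p' => u.fn) :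
    SmoothForm (volume.restrict Ω) (fun (U : Space Ω p) (V : Space Ω p') => D.terms U V 4)
      fun U W V x => D.derivTerms U W V 7 x + D.derivTerms U W V 8 x := by
  refine ((SmoothInLp.sum Finset.univ fun i _ =>
    (smooth_convecting_field (D := D) hp hT hu i).mul (c := m)
      (linearInLp_snd_grad i).smooth).pair hψ.space_snd).congr
    (fun U V => .of_forall fun x => ?_) fun U W V => .of_forall fun x => ?_
  · change _ = ⟪D.flux U x + (1 + (D.phi U).fn x) • U.2.2.1.fn x, U.2.1.grad x⟫ * V.2.1.fn x
    simp only [inner_eq_sum]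
  · change _ = ⟪D.fluxDeriv U W x + W.1.fn x • U.2.2.1.fn x + (1 + (D.phi U).fn x) • W.2.2.1.fn x,
        U.2.1.grad x⟫ * V.2.1.fn x
      + ⟪D.flux U x + (1 + (D.phi U).fn x) • U.2.2.1.fn x, W.2.1.grad x⟫ * V.2.1.fn x
    simp only [inner_eq_sum, Finset.sum_add_distrib, add_mul]

theorem smoothForm_heat_source [p.HolderConjugate p'] : SmoothForm (volume.restrict Ω)
    (fun (U : Space Ω p) (V : Space Ω p') => D.terms U V 5) fun _ _ _ _ => 0 := by
  refine ((SmoothInLp.const (Lp.memLp D.f).neg).pair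
    (linearInLp_fn (p := p')).space_snd).congr
    (fun U V => .of_forall fun x => ?_) fun U W V => .of_forall fun x => ?_
  · exact neg_mul _ _
  · exact zero_mul _

theorem smoothForm_viscosity (hT : LinearInLp (volume.restrict Ω) ⊤ fun u : Sobolev0 Ω p => u.fn) :
    SmoothForm (volume.restrict Ω) (fun (U : Space Ω p) (V : Space Ω p') => D.terms U V 6)
      fun U W V x => D.derivTerms U W V 9 x + D.derivTerms U W V 10 x := by
  refine (SmoothForm.sum Finset.univ fun i _ => SmoothForm.sum Finset.univ fun j _ =>
    (((smooth_phi (D := D) hT).superpose (D.contDiff_μ.div_const 2)).mul (c := 2)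
      (linearInLp_symGrad i j).space_velocity.smooth).pair
      ((linearInLp_symGrad i j).space_velocity (p := p'))).congr
    (fun U V => .of_forall fun x => ?_) fun U W V => .of_forall fun x => ?_
  · change _ = D.μ ((D.phi U).fn x) / 2 * frob (U.2.2.1.symGrad x) (V.2.2.1.symGrad x)
    simp only [frob, Finset.mul_sum, mul_assoc]
  · change _ = D.μ ((D.phi U).fn x) / 2 * frob (W.2.2.1.symGrad x) (V.2.2.1.symGrad x)
      + deriv D.μ ((D.phi U).fn x) / 2 * W.1.fn x * frob (U.2.2.1.symGrad x) (V.2.2.1.symGrad x)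
    simp only [frob, Finset.mul_sum, ← Finset.sum_add_distrib, deriv_div_const]
    refine Finset.sum_congr rfl fun i _ => Finset.sum_congr rfl fun j _ => ?_
    ring

theorem smoothForm_convection {m : ℝ≥0∞} [Fact (1 ≤ m)] [ENNReal.HolderTriple 3 2 m]
    [m.HolderConjugate 6] [IsFiniteMeasure (volume.restrict Ω)]
    (hp : 3 ≤ p) (hT : LinearInLp (volume.restrict Ω) ⊤ fun u : Sobolev0 Ω p => u.fn)
    (hu : ∀ i, LinearInLp (volume.restrict Ω) 6 fun (u : Velocity Ω) x => u.fn x i) :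
    SmoothForm (volume.restrict Ω) (fun (U : Space Ω p) (V : Space Ω p') => D.terms U V 7)
      fun U W V x => D.derivTerms U W V 11 x + D.derivTerms U W V 12 x := by
  refine (SmoothForm.sum Finset.univ fun i _ => (SmoothInLp.sum Finset.univ fun j _ =>
    (smooth_convecting_field (D := D) hp hT hu j).mul (c := m)
      (linearInLp_velocity_grad i j).space_velocity.smooth).pair
      ((hu i).space_velocity (p := p'))).congr
    (fun U V => .of_forall fun x => ?_) fun U W V => .of_forall fun x => ?_
  · change _ = ⟪Velocity.convect (fun y => D.flux U y + (1 + (D.phi U).fn y) • U.2.2.1.fn y)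
      U.2.2.1 x, V.2.2.1.fn x⟫
    simp only [inner_eq_sum, Velocity.convect]
  · change _ = ⟪Velocity.convect (fun y => D.fluxDeriv U W y + W.1.fn y • U.2.2.1.fn y
        + (1 + (D.phi U).fn y) • W.2.2.1.fn y) U.2.2.1 x, V.2.2.1.fn x⟫
      + ⟪Velocity.convect (fun y => D.flux U y + (1 + (D.phi U).fn y) • U.2.2.1.fn y)
        W.2.2.1 x, V.2.2.1.fn x⟫
    simp only [inner_eq_sum, Velocity.convect, Finset.sum_add_distrib, add_mul]

theorem smoothForm_pressure : SmoothForm (volume.restrict Ω)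
    (fun (U : Space Ω p) (V : Space Ω p') => D.terms U V 8)
    fun U W V => D.derivTerms U W V 13 := by
  refine (linearInLp_space_pressure.smooth.neg.pair
    (linearInLp_div.space_velocity (p := p'))).congr
    (fun U V => .of_forall fun x => ?_) fun U W V => .of_forall fun x => ?_
  · exact neg_mul _ _
  · exact neg_mul _ _

theorem smoothForm_force [IsFiniteMeasure (volume.restrict Ω)]
    (hu : ∀ i, LinearInLp (volume.restrict Ω) 6 fun (u : Velocity Ω) x => u.fn x i) :
    SmoothForm (volume.restrict Ω) (fun (U : Space Ω p) (V : Space Ω p') => D.terms U V 9)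
      fun _ _ _ _ => 0 := by
  refine (SmoothForm.sum Finset.univ fun i _ =>
    (SmoothInLp.const ((Lp.memLp D.g).eval_piLp i).neg).pair
      (((hu i).space_velocity (p := p')).mono (a := 2) (by norm_num))).congr
    (fun U V => .of_forall fun x => ?_) fun U W V => .of_forall fun x => ?_
  · change _ = -⟪D.g x, V.2.2.1.fn x⟫
    simp only [inner_eq_sum, Pi.neg_apply, neg_mul, Finset.sum_neg_distrib]
  · simp

theorem smoothForm_buoyancy [IsFiniteMeasure (volume.restrict Ω)]
    (hT : LinearInLp (volume.restrict Ω) ⊤ fun u : Sobolev0 Ω p => u.fn)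
    (hu : ∀ i, LinearInLp (volume.restrict Ω) 6 fun (u : Velocity Ω) x => u.fn x i) :
    SmoothForm (volume.restrict Ω) (fun (U : Space Ω p) (V : Space Ω p') => D.terms U V 10)
      fun U W V => D.derivTerms U W V 14 := by
  have he : ∀ i, MemLp (fun _ : E d => -D.eg i) 2 (volume.restrict Ω) := fun i => memLp_const _
  refine (SmoothForm.sum Finset.univ fun i _ =>
    (hT.space_snd.smooth.mul (c := 2) (SmoothInLp.const (he i))).pair
      (((hu i).space_velocity (p := p')).mono (a := 2) (by norm_num))).congr
    (fun U V => .of_forall fun x => ?_) fun U W V => .of_forall fun x => ?_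
  · change _ = -(U.2.1.fn x * ⟪D.eg, V.2.2.1.fn x⟫)
    simp only [inner_eq_sum, Finset.mul_sum, ← Finset.sum_neg_distrib]
    refine Finset.sum_congr rfl fun i _ => ?_
    ring
  · change _ = -(W.2.1.fn x * ⟪D.eg, V.2.2.1.fn x⟫)
    simp only [inner_eq_sum, Finset.mul_sum, ← Finset.sum_neg_distrib]
    refine Finset.sum_congr rfl fun i _ => ?_
    ring

theorem smoothForm_continuity : SmoothForm (volume.restrict Ω)
    (fun (U : Space Ω p) (V : Space Ω p') => D.terms U V 11)
    fun U W V => D.derivTerms U W V 15 := by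
  refine (linearInLp_div.space_velocity.smooth.pair (linearInLp_space_pressure (p := p'))).congr
    (fun U V => .of_forall fun x => ?_) fun U W V => .of_forall fun x => ?_
  · exact mul_comm _ _
  · exact mul_comm _ _

end Terms

/-! ### The product rule for `k(φ)Θ` -/

section ProductRule

variable {d : ℕ} {Ω : Set (E d)} {p p' : ℝ≥0∞} [Fact (1 ≤ p)] [Fact (1 ≤ p')] {D : Data Ω p}

theorem hasWeakGrad_conductivity_mul (hΩ : IsOpen Ω) [IsFiniteMeasure (volume.restrict Ω)]
    [p'.HolderConjugate p] (hpp : p' ≤ p) (U W : Space Ω p) :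
    HasWeakGrad Ω (fun x => D.k ((D.phi U).fn x) * W.2.1.fn x)
      fun x => D.k ((D.phi U).fn x) • W.2.1.grad x
        + W.2.1.fn x • deriv D.k ((D.phi U).fn x) • (D.phi U).grad x := by
  obtain ⟨C, hC⟩ := D.bounded_k
  have hk0 : ∀ s, |D.k s| ≤ C := fun s => by simpa using hC 0 (by simp) s
  have hk1 : ∀ s, |deriv D.k s| ≤ C := fun s => by simpa using hC 1 (by simp) s
  have hk : ContDiff ℝ 1 D.k := D.contDiff_k.of_le (by norm_num)
  have hφ := (D.phi U).memLp_fn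
  refine HasWeakGrad.mul_sobolev0 hΩ hpp ((D.phi U).hasWeakGrad.comp hΩ (hφ.integrable Fact.out)
    ((D.phi U).memLp_grad.integrable Fact.out) inferInstance hk hk0 hk1) ?_ ?_ W.2.1
  · exact memLp_top_of_bound (hk.continuous.comp_aestronglyMeasurable hφ.1) C
      (.of_forall fun x => hk0 _)
  · exact (D.phi U).memLp_grad.smul (memLp_top_of_bound
      ((hk.continuous_deriv le_rfl).comp_aestronglyMeasurable hφ.1) C (.of_forall fun x => hk1 _))

end ProductRule

/-! ### The integrals in the derivative -/

/-!
Where two entries of `Data.derivTerms` arise from one entry of `Data.terms`, only their sum is known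
to be integrable so far. Here one entry of each such pair is shown to be integrable; the other is a
difference of integrable functions.
-/

section Integrability

variable {d : ℕ} {Ω : Set (E d)} {p p' : ℝ≥0∞} [Fact (1 ≤ p)] [Fact (1 ≤ p')] {D : Data Ω p}

theorem integrable_derivTerms_thermodiffusion [p.HolderConjugate p']
    (hT : LinearInLp (volume.restrict Ω) ⊤ fun u : Sobolev0 Ω p => u.fn)
    (U W : Space Ω p) (V : Space Ω p') :
    Integrable (D.derivTerms U W V 2) (volume.restrict Ω) := by
  have h := ((smooth_phi (D := D) hT).superpose D.contDiff_h).memLp U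
  refine ((SmoothForm.sum Finset.univ fun i _ => ((SmoothInLp.const h).mul (c := p)
    (linearInLp_snd_grad i).smooth).pair (linearInLp_fst_grad (p := p') i)).integrable W V).congr
    (.of_forall fun x => ?_)
  change _ = D.h ((D.phi U).fn x) * ⟪W.2.1.grad x, V.1.grad x⟫
  simp only [inner_eq_sum, Finset.mul_sum, mul_assoc]

theorem integrable_derivTerms_transport {m s : ℝ≥0∞} [Fact (1 ≤ m)] [Fact (1 ≤ s)]
    [ENNReal.HolderTriple 3 p m] [m.HolderConjugate s] [IsFiniteMeasure (volume.restrict Ω)]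
    (hu : ∀ i, LinearInLp (volume.restrict Ω) 6 fun (u : Velocity Ω) x => u.fn x i)
    (hψ : LinearInLp (volume.restrict Ω) s fun u : Sobolev0 Ω p' => u.fn)
    (U W : Space Ω p) (V : Space Ω p') :
    Integrable (D.derivTerms U W V 3) (volume.restrict Ω) := by
  have h := fun i => ((hu i).mono (a := 3) (by norm_num)).memLp U.2.2.1
  refine (((SmoothInLp.sum Finset.univ fun i _ => (SmoothInLp.const (h i)).mul (c := m)
    (linearInLp_fst_grad i).smooth).pair hψ.space_fst).integrable W V).congr
    (.of_forall fun x => ?_)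
  change _ = ⟪U.2.2.1.fn x, W.1.grad x⟫ * V.1.fn x
  simp only [inner_eq_sum]

theorem integrable_derivTerms_conduction [p.HolderConjugate p']
    (hT : LinearInLp (volume.restrict Ω) ⊤ fun u : Sobolev0 Ω p => u.fn)
    (U W : Space Ω p) (V : Space Ω p') :
    Integrable (D.derivTerms U W V 6) (volume.restrict Ω) := by
  have hφ := (smooth_phi (D := D) hT).superpose D.contDiff_k
  -- both are values of the derivative of `φ ↦ k(φ)` as a map into `L_∞`
  have h1 : MemLp (fun x => deriv D.k ((D.phi U).fn x) * W.1.fn x) ⊤ (volume.restrict Ω) :=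
    hφ.memLp_deriv U W
  have h2 : MemLp (fun x => deriv D.k ((D.phi U).fn x) * W.2.1.fn x) ⊤ (volume.restrict Ω) :=
    hφ.memLp_deriv U (W.2.1, 0)
  have h3 := fun i => (linearInLp_snd_grad (p := p) i).memLp U
  have h4 := fun i => (smooth_phi_grad (D := D) i).memLp U
  refine (integrable_finsetSum Finset.univ fun i _ => memLp_one_iff_integrable.1
    (((linearInLp_snd_grad (p := p') i).memLp V).mul
      (((h3 i).mul (r := p) h1).sub ((h4 i).mul (r := p) h2)))).congr (.of_forall fun x => ?_)
  change _ = deriv D.k ((D.phi U).fn x)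
    * ⟪W.1.fn x • U.2.1.grad x - W.2.1.fn x • (D.phi U).grad x, V.2.1.grad x⟫
  simp only [inner_eq_sum, Finset.mul_sum, PiLp.sub_apply, PiLp.smul_apply, smul_eq_mul,
    Pi.mul_apply, Pi.sub_apply]
  refine Finset.sum_congr rfl fun i _ => ?_
  ring

theorem integrable_derivTerms_heat_convection {m s : ℝ≥0∞} [Fact (1 ≤ m)] [Fact (1 ≤ s)]
    [ENNReal.HolderTriple 3 p m] [m.HolderConjugate s] [IsFiniteMeasure (volume.restrict Ω)]
    (hp : 3 ≤ p) (hT : LinearInLp (volume.restrict Ω) ⊤ fun u : Sobolev0 Ω p => u.fn)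
    (hu : ∀ i, LinearInLp (volume.restrict Ω) 6 fun (u : Velocity Ω) x => u.fn x i)
    (hψ : LinearInLp (volume.restrict Ω) s fun u : Sobolev0 Ω p' => u.fn)
    (U W : Space Ω p) (V : Space Ω p') :
    Integrable (D.derivTerms U W V 8) (volume.restrict Ω) := by
  have h := fun i => (smooth_convecting_field (D := D) hp hT hu i).memLp U
  refine (((SmoothInLp.sum Finset.univ fun i _ => (SmoothInLp.const (h i)).mul (c := m)
    (linearInLp_snd_grad i).smooth).pair hψ.space_snd).integrable W V).congr
    (.of_forall fun x => ?_)
  change _ = ⟪D.flux U x + (1 + (D.phi U).fn x) • U.2.2.1.fn x, W.2.1.grad x⟫ * V.2.1.fn x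
  simp only [inner_eq_sum]

theorem integrable_derivTerms_viscosity
    (hT : LinearInLp (volume.restrict Ω) ⊤ fun u : Sobolev0 Ω p => u.fn)
    (U W : Space Ω p) (V : Space Ω p') :
    Integrable (D.derivTerms U W V 9) (volume.restrict Ω) := by
  have h := ((smooth_phi (D := D) hT).superpose (D.contDiff_μ.div_const 2)).memLp U
  refine ((SmoothForm.sum Finset.univ fun i _ => SmoothForm.sum Finset.univ fun j _ =>
    ((SmoothInLp.const h).mul (c := 2) (linearInLp_symGrad i j).space_velocity.smooth).pair
      ((linearInLp_symGrad i j).space_velocity (p := p'))).integrable W V).congr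
    (.of_forall fun x => ?_)
  change _ = D.μ ((D.phi U).fn x) / 2 * frob (W.2.2.1.symGrad x) (V.2.2.1.symGrad x)
  simp only [frob, Finset.mul_sum, mul_assoc]

theorem integrable_derivTerms_convection {m : ℝ≥0∞} [Fact (1 ≤ m)] [ENNReal.HolderTriple 3 2 m]
    [m.HolderConjugate 6] [IsFiniteMeasure (volume.restrict Ω)]
    (hp : 3 ≤ p) (hT : LinearInLp (volume.restrict Ω) ⊤ fun u : Sobolev0 Ω p => u.fn)
    (hu : ∀ i, LinearInLp (volume.restrict Ω) 6 fun (u : Velocity Ω) x => u.fn x i)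
    (U W : Space Ω p) (V : Space Ω p') :
    Integrable (D.derivTerms U W V 12) (volume.restrict Ω) := by
  have h := fun i => (smooth_convecting_field (D := D) hp hT hu i).memLp U
  refine ((SmoothForm.sum Finset.univ fun i _ => (SmoothInLp.sum Finset.univ fun j _ =>
    (SmoothInLp.const (h j)).mul (c := m)
      (linearInLp_velocity_grad i j).space_velocity.smooth).pair
      ((hu i).space_velocity (p := p'))).integrable W V).congr
    (.of_forall fun x => ?_)
  change _ = ⟪Velocity.convect (fun y => D.flux U y + (1 + (D.phi U).fn y) • U.2.2.1.fn y)
      W.2.2.1 x, V.2.2.1.fn x⟫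
  simp only [inner_eq_sum, Velocity.convect]

theorem _root_.MeasureTheory.Integrable.of_add_left {α : Type*} [MeasurableSpace α] {μ : Measure α}
    {f g : α → ℝ} (h : Integrable (fun x => f x + g x) μ) (hg : Integrable g μ) :
    Integrable f μ :=
  (h.sub hg).congr (.of_forall fun x => add_sub_cancel_right (f x) (g x))

theorem _root_.MeasureTheory.Integrable.of_add_right {α : Type*} [MeasurableSpace α] {μ : Measure α}
    {f g : α → ℝ} (h : Integrable (fun x => f x + g x) μ) (hf : Integrable f μ) :
    Integrable g μ :=
  (h.sub hf).congr (.of_forall fun x => add_sub_cancel_left (f x) (g x))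

end Integrability

/-! ### Assembly of the form -/

section Assembly

variable {d : ℕ} {Ω : Set (E d)} {p p' : ℝ≥0∞} [Fact (1 ≤ p)] [Fact (1 ≤ p')] {D : Data Ω p}

/-- Given the embeddings of the scalar unknowns into `L_∞`, of velocities into `L_6` and of scalar
test functions into `L_s`, all integrands are integrable, and the sum of the integrals of
`Data.terms` is a differentiable form with derivative the sum of the integrals of
`Data.derivTerms`. -/
theorem smoothForm_total {m₁ s m₂ : ℝ≥0∞} [Fact (1 ≤ m₁)] [Fact (1 ≤ s)] [Fact (1 ≤ m₂)]
    [ENNReal.HolderTriple 3 p m₁] [m₁.HolderConjugate s] [ENNReal.HolderTriple 3 2 m₂]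
    [m₂.HolderConjugate 6] [p.HolderConjugate p'] [IsFiniteMeasure (volume.restrict Ω)]
    (hΩ : IsOpen Ω) (hp : 3 ≤ p) (hpp : p' ≤ p)
    (hT : LinearInLp (volume.restrict Ω) ⊤ fun u : Sobolev0 Ω p => u.fn)
    (hu : ∀ i, LinearInLp (volume.restrict Ω) 6 fun (u : Velocity Ω) x => u.fn x i)
    (hψ : LinearInLp (volume.restrict Ω) s fun u : Sobolev0 Ω p' => u.fn) :
    (∀ (U : Space Ω p) (V : Space Ω p') (i : Fin 12),
      Integrable (D.terms U V i) (volume.restrict Ω)) ∧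
    (∀ (U W : Space Ω p) (V : Space Ω p') (i : Fin 16),
      Integrable (D.derivTerms U W V i) (volume.restrict Ω)) ∧
    SmoothForm (volume.restrict Ω)
      (fun (U : Space Ω p) (V : Space Ω p') x => ∑ i, D.terms U V i x)
      fun U W V x => ∑ i, D.derivTerms U W V i x := by
  have : p'.HolderConjugate p := ENNReal.HolderConjugate.symm
  have h0 := smoothForm_diffusion (p' := p') (D := D)
  have h1 := smoothForm_thermodiffusion (p' := p') (D := D) hT
  have h2 := smoothForm_transport (m := m₁) (D := D) hu hψ
  have h3 := smoothForm_conduction (p' := p') (D := D) hΩ hT (hasWeakGrad_conductivity_mul hΩ hpp)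
  have h4 := smoothForm_heat_convection (m := m₁) (D := D) hp hT hu hψ
  have h5 := smoothForm_heat_source (p' := p') (D := D)
  have h6 := smoothForm_viscosity (p' := p') (D := D) hT
  have h7 := smoothForm_convection (m := m₂) (p' := p') (D := D) hp hT hu
  have h8 := smoothForm_pressure (p' := p') (D := D)
  have h9 := smoothForm_force (p' := p') (D := D) hu
  have h10 := smoothForm_buoyancy (p' := p') (D := D) hT hu
  have h11 := smoothForm_continuity (p' := p') (D := D)
  refine ⟨fun U V i => ?_, fun U W V i => ?_, ?_⟩
  · fin_cases i
    exacts [h0.integrable U V, h1.integrable U V, h2.integrable U V, h3.integrable U V,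
      h4.integrable U V, h5.integrable U V, h6.integrable U V, h7.integrable U V,
      h8.integrable U V, h9.integrable U V, h10.integrable U V, h11.integrable U V]
  · have k2 := integrable_derivTerms_thermodiffusion (D := D) hT U W V
    have k3 := integrable_derivTerms_transport (D := D) (m := m₁) hu hψ U W V
    have k6 := integrable_derivTerms_conduction (D := D) hT U W V
    have k8 := integrable_derivTerms_heat_convection (D := D) (m := m₁) hp hT hu hψ U W V
    have k9 := integrable_derivTerms_viscosity (D := D) hT U W V
    have k12 := integrable_derivTerms_convection (D := D) (m := m₂) hp hT hu U W V
    fin_cases i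
    exacts [h0.integrable_deriv U W V, (h1.integrable_deriv U W V).of_add_left k2, k2, k3,
      (h2.integrable_deriv U W V).of_add_right k3, (h3.integrable_deriv U W V).of_add_left k6, k6,
      (h4.integrable_deriv U W V).of_add_left k8, k8, k9,
      (h6.integrable_deriv U W V).of_add_right k9, (h7.integrable_deriv U W V).of_add_left k12,
      k12, h8.integrable_deriv U W V, h10.integrable_deriv U W V, h11.integrable_deriv U W V]
  · refine (h0.add <| h1.add <| h2.add <| h3.add <| h4.add <| h5.add <| h6.add <| h7.add <|
      h8.add <| h9.add <| h10.add h11).congr (fun U V => .of_forall fun x => ?_)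
      fun U W V => .of_forall fun x => ?_
    · have : ∀ a : Fin 12 → ℝ, a 0 + (a 1 + (a 2 + (a 3 + (a 4 + (a 5 + (a 6 + (a 7 + (a 8
          + (a 9 + (a 10 + a 11)))))))))) = ∑ i, a i := fun a => by
        simp only [Fin.sum_univ_succ, Fin.sum_univ_zero]
        simp
      exact this fun i => D.terms U V i x
    · have : ∀ a : Fin 16 → ℝ, a 0 + ((a 1 + a 2) + ((a 3 + a 4) + ((a 5 + a 6) + ((a 7 + a 8)
          + (0 + ((a 9 + a 10) + ((a 11 + a 12) + (a 13 + (0 + (a 14 + a 15))))))))))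
          = ∑ i, a i := fun a => by
        simp only [Fin.sum_univ_succ, Fin.sum_univ_zero]
        simp [add_assoc]
      exact this fun i => D.derivTerms U W V i x

end Assembly

end Nanofluid

theorem lemmaL {d : ℕ} (hd : d = 2 ∨ d = 3) (Ω : Set (Nanofluid.E d))
    (hΩ : Nanofluid.IsC2Domain Ω) (p p' : ℝ≥0∞) [Fact (1 ≤ p)] [Fact (1 ≤ p')]
    (hp : 3 < p) (hp_top : p ≠ ⊤) (hpp' : p.HolderConjugate p') (D : Nanofluid.Data Ω p) :
    -- all integrals in the definitions of `F` and `DF` are well defined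
    (∀ (U : Nanofluid.Space Ω p) (V : Nanofluid.Space Ω p') (i : Fin 12),
      Integrable (D.terms U V i) (volume.restrict Ω)) ∧
    (∀ (U W : Nanofluid.Space Ω p), ∃ G : Nanofluid.E d → Nanofluid.E d,
      Nanofluid.HasWeakGrad Ω (fun x => D.k ((D.phi U).fn x) * W.2.1.fn x) G) ∧
    (∀ (U W : Nanofluid.Space Ω p) (V : Nanofluid.Space Ω p') (i : Fin 16),
      Integrable (D.derivTerms U W V i) (volume.restrict Ω)) ∧
    ∃ (F : Nanofluid.Space Ω p → (Nanofluid.Space Ω p' →L[ℝ] ℝ))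
      (DF : Nanofluid.Space Ω p → (Nanofluid.Space Ω p →L[ℝ] (Nanofluid.Space Ω p' →L[ℝ] ℝ))),
      (∀ U V, F U V = D.form U V) ∧
      (∀ U W V, DF U W V = D.derivForm U W V) ∧
      (∀ U, HasFDerivAt F (DF U) U) ∧
      (∀ (U : Nanofluid.Space Ω p) (r₀ : ℝ), 0 < r₀ →
        ∃ L : ℝ, 0 ≤ L ∧ ∀ V ∈ Metric.ball U r₀, ‖DF U - DF V‖ ≤ L * ‖U - V‖) := by
  open Nanofluid in
  have hfin : IsFiniteMeasure (volume.restrict Ω) := ⟨by simpa using hΩ.isBounded.measure_lt_top⟩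
  obtain ⟨m₁, s, r, hm₁, hs, hm₁p, hm₁s, hs_top, rfl, hr1, hr2, hrs, hpp⟩ :=
    exists_exponents hp hp_top hpp'
  obtain ⟨m₂, hm₂, h32, hm₂6⟩ := exists_exponent_three_two
  have : Fact (1 ≤ m₁) := ⟨hm₁⟩
  have : Fact (1 ≤ s) := ⟨hs⟩
  have : Fact (1 ≤ m₂) := ⟨hm₂⟩
  have : (r : ℝ≥0∞).HolderConjugate p := hpp'.symm
  have hd2 : 2 ≤ d := by omega
  have hd3 : d ≤ 3 := by omega
  have hT : LinearInLp (volume.restrict Ω) ⊤ fun u : Sobolev0 Ω p => u.fn :=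
    linearInLp_top hΩ.isOpen (lt_of_le_of_lt (mod_cast hd3) hp) hp_top
  have hu := linearInLp_velocity hd hΩ.isOpen hΩ.isBounded
  have hψ : LinearInLp (volume.restrict Ω) s fun u : Sobolev0 Ω (r : ℝ≥0∞) => u.fn := by
    refine linearInLp_sobolev hΩ.isOpen hΩ.isBounded hs_top hr1 le_rfl
      (hr2.trans_le (mod_cast hd2)) (le_trans ?_ hrs)
    have : (0 : ℝ) < d := by positivity
    have : (d : ℝ) ≤ 3 := mod_cast hd3
    gcongr
  obtain ⟨hI, hI', T, T', hT', h1, h2⟩ :=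
    smoothForm_total (D := D) (m₁ := m₁) (m₂ := m₂) hΩ.isOpen hp.le hpp hT hu hψ
  refine ⟨hI, fun U W => ⟨_, hasWeakGrad_conductivity_mul hΩ.isOpen hpp U W⟩, hI', T, T',
    fun U V => ?_, fun U W V => ?_, hT'.hasFDerivAt, fun U r₀ _ => ?_⟩
  · rw [(h1 U V).2, Data.form, integral_finsetSum _ fun i _ => hI U V i]
  · rw [(h2 U W V).2, Data.derivForm, integral_finsetSum _ fun i _ => hI' U W V i]
  -- the ball of radius `r₀` around `U` is contained in that of radius `‖U‖ + r₀` around `0`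
  · obtain ⟨L, hL, h⟩ := hT'.lip (‖U‖ + r₀)
    refine ⟨L, hL, fun V hV => h U V (by linarith) ?_⟩
    have := norm_le_norm_add_norm_sub' V U
    rw [mem_ball_iff_norm] at hV
    linarith

end
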